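/- Let $\Bbbk$ be a unital commutative ring, $A$ a unital associative $\Bbbk$-algebra, and $\Omega_d^\bullet$ an exterior algebra over $A$, that is, a differential graded $\Bbbk$-algebra with $\Omega_d^0=A$ that is generated as an algebra by $A$ and $dA$. Let $J_d^1A=(A\otimes_{\Bbbk}A)/N_d$, where $N_d=\{\sum a_i\otimes b_i:\sum a_ib_i=0,\ \sum a_i\,db_i=0\}$, let $J_d^1M=J_d^1A\otimes_AM$ and $j_d^1(m)=[1\otimes 1]\otimes m$ for a left $A$-module $M$. The holonomic jet modules are $J_d^0M=M$, $J_d^1M$ and, for $n\ge 2$, $J_d^nM\subseteq J_d^1J_d^{n-1}M$ is the kernel of $\widetilde{\mathbb D}\circ J_d^1(l^{n-1})$, where $l^{n-1}:J_d^{n-1}M\to J_d^1J_d^{n-2}M$ is the inclusion (the identity for $n=2$) and $$\widetilde{\mathbb D}:J_d^1J_d^1P\to(\Omega_d^1\otimes_AP)\times(\Omega_d^2\otimes_AP),\qquad [a\otimes b]\otimes[c\otimes f]\otimes p\mapsto\bigl(a\,d(bc)f\otimes p,\ da\wedge d(bc)f\otimes p\bigr);$$ the prolongations are $j_d^0=\mathrm{id}$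 and $j_d^n=j_d^1\circ j_d^{n-1}:M\to J_d^nM$. For left $A$-modules $E,F$, a linear differential operator $E\to F$ of order at most $n$ is a $\Bbbk$-linear map of the form $\tilde\Delta\circ j_d^n$ with $\tilde\Delta:J_d^nE\to F$ an $A$-linear map; these form $\mathrm{Diff}_d^n(E,F)$. Put $\mathrm{Diff}_d^{-1}(E,F)=0$, $\mathrm{Diff}_d(E,F)=\bigcup_n\mathrm{Diff}_d^n(E,F)$, $\mathrm{Symb}_d^n(E,F)=\mathrm{Diff}_d^n(E,F)/\mathrm{Diff}_d^{n-1}(E,F)$ with quotient map $\varsigma^n$, and $\mathrm{Symb}_d^\bullet(E,F)=\bigoplus_{n\ge0}\mathrm{Symb}_d^n(E,F)$. The symbol algebra is $\mathrm{Symb}_d^\bullet(E,E)$ with the product $\varsigma^n(\Delta_1)\cdot\varsigma^m(\Delta_2)=\varsigma^{n+m}(\Delta_1\circ\Delta_2)$ and unit $\varsigma^0(\mathrm{id}_E)$. Let $E$ be a left $A$-module and let $q=\sum_nq^n:\mathrm{Symb}_d^\bullet(E,E)\to\mathrm{Diff}_d(E,E)$ be a full quantization for $(E,E)$: every $q^n:\mathrm{Symb}_d^n(E,E)\to\mathrm{Diff}_d^n(E,E)$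 is ${}_A\mathrm{Hom}(E,E)$-linear (for the action by composition on the left) and $\varsigma^n\circ q^n=\mathrm{id}$. For $\Delta\in\mathrm{Diff}_d^N(E,E)$ let $T^k=\Delta$ for $k\ge N$, let $T^k=T^{k+1}-q^{k+1}(\varsigma^{k+1}(T^{k+1}))$ for $0\le k<N$, and let $[\Delta]_q^k=\varsigma^k(T^k)$. For $\hbar\in\Bbbk$ let $\star_\hbar$ be the $\Bbbk$-bilinear operation on $\mathrm{Symb}_d^\bullet(E,E)$ with $$a\star_\hbar b=\sum_{k=0}^{n+m}\hbar^k\,[q^n(a)\circ q^m(b)]_q^{n+m-k}\qquad(a\in\mathrm{Symb}_d^n(E,E),\ b\in\mathrm{Symb}_d^m(E,E)).$$ Then: (i) $(\mathrm{Symb}_d^\bullet(E,E),\star_0)=(\mathrm{Symb}_d^\bullet(E,E),\cdot)$, that is, $a\star_0b=a\cdot b$ for all $a,b\in\mathrm{Symb}_d^\bullet(E,E)$. (ii) The map $q$ is an isomorphism of unital $\Bbbk$-algebras $(\mathrm{Symb}_d^\bullet(E,E),\star_1)\cong(\mathrm{Diff}_d(E,E),\circ)$: it is $\Bbbk$-linear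 and bijective, $q(a\star_1b)=q(a)\circ q(b)$ for all $a,b\in\mathrm{Symb}_d^\bullet(E,E)$, and $q(\varsigma^0(\mathrm{id}_E))=\mathrm{id}_E$. -/

import Mathlib

universe u v w x y

noncomputable section

open scoped TensorProduct DirectSum

namespace NCDiff

section BalancedTensor

/-- The relations `(x · a) ⊗ m = x ⊗ (a · m)` that define `X ⊗_A M` as a quotient of `X ⊗_ℤ M`. -/
def balancedRel (A : Type u) (X : Type v) (M : Type w) [Ring A] [AddCommGroup X] [Module A X]
    [Module Aᵐᵒᵖ X] [SMulCommClass A Aᵐᵒᵖ X] [AddCommGroup M] [Module A M] :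
    Submodule A (X ⊗[ℤ] M) :=
  Submodule.span A {t | ∃ (x : X) (a : A) (m : M),
    t = (MulOpposite.op a • x) ⊗ₜ[ℤ] m - x ⊗ₜ[ℤ] (a • m)}

/-- The tensor product `X ⊗_A M` of an `A`-bimodule `X` and a left `A`-module `M` over a
not necessarily commutative ring `A`, as a left `A`-module.  (The `A`-span in the relations is the
additive span, because `a' • ((x · a) ⊗ m - x ⊗ (a • m))` is again such a relation.) -/
def BTensor (A : Type u) (X : Type v) (M : Type w) [Ring A] [AddCommGroup X] [Module A X]
    [Module Aᵐᵒᵖ X] [SMulCommClass A Aᵐᵒᵖ X] [AddCommGroup M] [Module A M] : Type (max v w) :=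
  (X ⊗[ℤ] M) ⧸ balancedRel A X M

variable {A : Type u} {X : Type v} {M : Type w} [Ring A] [AddCommGroup X] [Module A X]
    [Module Aᵐᵒᵖ X] [SMulCommClass A Aᵐᵒᵖ X] [AddCommGroup M] [Module A M]

instance : AddCommGroup (BTensor A X M) :=
  inferInstanceAs (AddCommGroup ((X ⊗[ℤ] M) ⧸ balancedRel A X M))

instance : Module A (BTensor A X M) :=
  inferInstanceAs (Module A ((X ⊗[ℤ] M) ⧸ balancedRel A X M))

/-- The class of `x ⊗ m` in `X ⊗_A M`. -/
def BTensor.tmul (x : X) (m : M) : BTensor A X M :=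
  (balancedRel A X M).mkQ (x ⊗ₜ[ℤ] m)

theorem BTensor.tmul_add (x : X) (m m' : M) :
    BTensor.tmul (A := A) x (m + m') = BTensor.tmul x m + BTensor.tmul x m' := by
  simp only [BTensor.tmul, TensorProduct.tmul_add, map_add]; rfl

theorem BTensor.add_tmul (x x' : X) (m : M) :
    BTensor.tmul (A := A) (x + x') m = BTensor.tmul x m + BTensor.tmul x' m := by
  simp only [BTensor.tmul, TensorProduct.add_tmul, map_add]; rfl

theorem BTensor.smul_tmul (a : A) (x : X) (m : M) :
    a • BTensor.tmul (A := A) x m = BTensor.tmul (a • x) m := by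
  simp only [BTensor.tmul, ← TensorProduct.smul_tmul', map_smul]; rfl

theorem BTensor.op_smul_tmul (a : A) (x : X) (m : M) :
    BTensor.tmul (A := A) (MulOpposite.op a • x) m = BTensor.tmul x (a • m) := by
  refine (Submodule.Quotient.eq (balancedRel A X M)).2 ?_
  exact Submodule.subset_span ⟨x, a, m, rfl⟩

theorem BTensor.induction {p : BTensor A X M → Prop} (h0 : p 0)
    (ht : ∀ x m, p (BTensor.tmul x m)) (ha : ∀ s t, p s → p t → p (s + t)) (t : BTensor A X M) :
    p t := by
  obtain ⟨t, rfl⟩ := (balancedRel A X M).mkQ_surjective t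
  induction t using TensorProduct.induction_on with
  | zero => rw [map_zero]; exact h0
  | tmul x m => exact ht x m
  | add s t hs ht => rw [map_add]; exact ha _ _ hs ht

/-- Additive maps out of `X ⊗_A M` from balanced biadditive maps. -/
def BTensor.lift {P : Type x} [AddCommGroup P] (f : X →+ M →+ P)
    (hf : ∀ (x : X) (a : A) (m : M), f (MulOpposite.op a • x) m = f x (a • m)) :
    BTensor A X M →+ P :=
  QuotientAddGroup.lift (balancedRel A X M).toAddSubgroup
    (TensorProduct.liftAddHom (R := ℤ) f (fun r x m => by simp)) (by
      intro t ht
      have key : ∀ t ∈ balancedRel A X M, ∀ c : A,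
          TensorProduct.liftAddHom (R := ℤ) f (fun r x m => by simp) (c • t) = 0 := by
        intro t ht
        induction ht using Submodule.span_induction with
        | mem t h =>
          obtain ⟨x, a, m, rfl⟩ := h
          intro c
          rw [smul_sub, TensorProduct.smul_tmul', TensorProduct.smul_tmul', map_sub,
            TensorProduct.liftAddHom_tmul, TensorProduct.liftAddHom_tmul, smul_comm, hf, sub_self]
        | zero => intro c; rw [smul_zero, map_zero]
        | add s t _ _ hs ht => intro c; rw [smul_add, map_add, hs, ht, add_zero]
        | smul b t _ ht => intro c; rw [smul_smul]; exact ht _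
      have := key t ht 1
      rwa [one_smul] at this)

@[simp] theorem BTensor.lift_tmul {P : Type x} [AddCommGroup P] (f : X →+ M →+ P)
    (hf : ∀ (x : X) (a : A) (m : M), f (MulOpposite.op a • x) m = f x (a • m)) (x : X) (m : M) :
    BTensor.lift f hf (BTensor.tmul x m) = f x m :=
  TensorProduct.liftAddHom_tmul (R := ℤ) f (fun r x m => by simp) x m

/-- `x ↦ m ↦ x ⊗ m` as a biadditive map. -/
def BTensor.mk (A : Type u) (X : Type v) (M : Type w) [Ring A] [AddCommGroup X] [Module A X]
    [Module Aᵐᵒᵖ X] [SMulCommClass A Aᵐᵒᵖ X] [AddCommGroup M] [Module A M] :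
    X →+ M →+ BTensor A X M :=
  AddMonoidHom.mk' (fun x => AddMonoidHom.mk' (fun m => BTensor.tmul x m) (BTensor.tmul_add x))
    (fun x x' => by ext m; exact BTensor.add_tmul x x' m)

@[simp] theorem BTensor.mk_apply (x : X) (m : M) : BTensor.mk A X M x m = BTensor.tmul x m := rfl

/-- The additive map `X ⊗_A f`. -/
def BTensor.mapAux (X : Type v) [AddCommGroup X] [Module A X]
    [Module Aᵐᵒᵖ X] [SMulCommClass A Aᵐᵒᵖ X] {N : Type y} [AddCommGroup N] [Module A N]
    (f : M →ₗ[A] N) : BTensor A X M →+ BTensor A X N :=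
  BTensor.lift
    (AddMonoidHom.mk' (fun x => (BTensor.mk A X N x).comp f.toAddMonoidHom)
      (fun x x' => by ext m; simp))
    (fun x a m => by simp [BTensor.op_smul_tmul])

theorem BTensor.mapAux_tmul {N : Type y} [AddCommGroup N] [Module A N]
    (f : M →ₗ[A] N) (x : X) (m : M) :
    BTensor.mapAux X f (BTensor.tmul x m) = BTensor.tmul x (f m) := by
  rw [BTensor.mapAux]
  exact Eq.trans (BTensor.lift_tmul _ _ _ _) rfl

/-- The `A`-linear map `X ⊗_A f`. -/
def BTensor.map (X : Type v) [AddCommGroup X] [Module A X]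
    [Module Aᵐᵒᵖ X] [SMulCommClass A Aᵐᵒᵖ X] {N : Type y} [AddCommGroup N] [Module A N]
    (f : M →ₗ[A] N) : BTensor A X M →ₗ[A] BTensor A X N where
  toFun := BTensor.mapAux X f
  map_add' := map_add _
  map_smul' a t := by
    induction t using BTensor.induction with
    | h0 => simp
    | ht x m =>
      rw [BTensor.smul_tmul, BTensor.mapAux_tmul, BTensor.mapAux_tmul, RingHom.id_apply,
        BTensor.smul_tmul]
    | ha s t hs ht => rw [smul_add, map_add, hs, ht, map_add, smul_add]

@[simp] theorem BTensor.map_tmul {N : Type y} [AddCommGroup N] [Module A N]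
    (f : M →ₗ[A] N) (x : X) (m : M) :
    BTensor.map X f (BTensor.tmul x m) = BTensor.tmul x (f m) :=
  BTensor.mapAux_tmul f x m

end BalancedTensor

section Calculus

/-- An exterior algebra over the unital associative `k`-algebra `A`: a differential graded algebra
`Ω = ⨁ Ωⁿ` over `k` with `Ω⁰ = A`, generated as an algebra by `A` and `dA`. -/
structure ExtAlg (k : Type w) (A : Type u) (Ω : Type v) [CommRing k] [Ring A] [Algebra k A]
    [Ring Ω] [Algebra k Ω] where
  /-- the homogeneous components `Ωⁿ` -/
  gr : ℕ → Submodule k Ω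
  gradedMonoid : SetLike.GradedMonoid gr
  isInternal : DirectSum.IsInternal gr
  /-- the identification of `A` with `Ω⁰` -/
  base : A →ₐ[k] Ω
  base_injective : Function.Injective base
  range_base : LinearMap.range base.toLinearMap = gr 0
  /-- the exterior derivative -/
  d : Ω →ₗ[k] Ω
  d_mem : ∀ (n : ℕ) (x : Ω), x ∈ gr n → d x ∈ gr (n + 1)
  d_d : ∀ x : Ω, d (d x) = 0
  leibniz : ∀ (n : ℕ) (x y : Ω), x ∈ gr n → d (x * y) = d x * y + (-1) ^ n * (x * d y)
  generated : Algebra.adjoin k (Set.range base ∪ Set.range fun a => d (base a)) = ⊤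

variable {k : Type w} {A : Type u} {Ω : Type v} [CommRing k] [Ring A] [Algebra k A]
    [Ring Ω] [Algebra k Ω] (Γ : ExtAlg k A Ω)

namespace ExtAlg

theorem base_mem (a : A) : Γ.base a ∈ Γ.gr 0 := by
  rw [← Γ.range_base]; exact ⟨a, rfl⟩

theorem base_mul_mem {n : ℕ} (a : A) {x : Ω} (hx : x ∈ Γ.gr n) : Γ.base a * x ∈ Γ.gr n := by
  have := Γ.gradedMonoid.mul_mem (Γ.base_mem a) hx
  rwa [zero_add] at this

theorem mul_base_mem {n : ℕ} (a : A) {x : Ω} (hx : x ∈ Γ.gr n) : x * Γ.base a ∈ Γ.gr n := by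
  have := Γ.gradedMonoid.mul_mem hx (Γ.base_mem a)
  rwa [add_zero] at this

theorem d_base_mul (a b : A) :
    Γ.d (Γ.base (a * b)) = Γ.d (Γ.base a) * Γ.base b + Γ.base a * Γ.d (Γ.base b) := by
  rw [map_mul, Γ.leibniz 0 _ _ (Γ.base_mem a), pow_zero, one_mul]

theorem d_one : Γ.d 1 = 0 := by
  have := Γ.d_base_mul 1 1
  simpa using this

/-- The `A`-bimodule `Ωⁿ` of `n`-forms. -/
def Form (n : ℕ) : Type v := ↥(Γ.gr n)

instance (n : ℕ) : AddCommGroup (Γ.Form n) := inferInstanceAs (AddCommGroup ↥(Γ.gr n))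

/-- The underlying element of `Ω`. -/
def Form.val {n : ℕ} : Γ.Form n →+ Ω := (Γ.gr n).subtype.toAddMonoidHom

theorem Form.ext {n : ℕ} {x y : Γ.Form n} (h : Form.val Γ x = Form.val Γ y) : x = y :=
  Subtype.ext h

/-- An element of `Ω` that lies in degree `n`, as an `n`-form. -/
def Form.of {n : ℕ} (x : Ω) (hx : x ∈ Γ.gr n) : Γ.Form n := ⟨x, hx⟩

@[simp] theorem Form.val_of {n : ℕ} (x : Ω) (hx : x ∈ Γ.gr n) :
    Form.val Γ (Form.of Γ x hx) = x := rfl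

theorem Form.val_mem {n : ℕ} (x : Γ.Form n) : Form.val Γ x ∈ Γ.gr n := x.2

instance (n : ℕ) : Module A (Γ.Form n) where
  smul a x := Form.of Γ (Γ.base a * Form.val Γ x) (Γ.base_mul_mem a x.2)
  one_smul x := Form.ext Γ (by change Γ.base 1 * _ = _; simp)
  mul_smul a b x := Form.ext Γ (by
    change Γ.base (a * b) * _ = Γ.base a * (Γ.base b * _); simp [mul_assoc])
  smul_zero a := Form.ext Γ (by change Γ.base a * Form.val Γ 0 = Form.val Γ 0; simp)
  smul_add a x y := Form.ext Γ (by
    change Γ.base a * Form.val Γ (x + y) = Γ.base a * Form.val Γ x + Γ.base a * Form.val Γ y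
    simp [mul_add])
  add_smul a b x := Form.ext Γ (by
    change Γ.base (a + b) * Form.val Γ x = Γ.base a * Form.val Γ x + Γ.base b * Form.val Γ x
    simp [add_mul])
  zero_smul x := Form.ext Γ (by change Γ.base 0 * Form.val Γ x = Form.val Γ 0; simp)

instance (n : ℕ) : Module Aᵐᵒᵖ (Γ.Form n) where
  smul a x := Form.of Γ (Form.val Γ x * Γ.base a.unop) (Γ.mul_base_mem a.unop x.2)
  one_smul x := Form.ext Γ (by change _ * Γ.base 1 = _; simp)
  mul_smul a b x := Form.ext Γ (by
    change _ * Γ.base (b.unop * a.unop) = _ * Γ.base b.unop * Γ.base a.unop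
    rw [map_mul, mul_assoc])
  smul_zero a := Form.ext Γ (by change Form.val Γ 0 * Γ.base a.unop = Form.val Γ 0; simp)
  smul_add a x y := Form.ext Γ (by
    change Form.val Γ (x + y) * Γ.base a.unop
      = Form.val Γ x * Γ.base a.unop + Form.val Γ y * Γ.base a.unop
    simp [add_mul])
  add_smul a b x := Form.ext Γ (by
    change Form.val Γ x * Γ.base (a.unop + b.unop)
      = Form.val Γ x * Γ.base a.unop + Form.val Γ x * Γ.base b.unop
    simp [mul_add])
  zero_smul x := Form.ext Γ (by change Form.val Γ x * Γ.base 0 = Form.val Γ 0; simp)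

@[simp] theorem Form.val_smul {n : ℕ} (a : A) (x : Γ.Form n) :
    Form.val Γ (a • x) = Γ.base a * Form.val Γ x := rfl

@[simp] theorem Form.val_op_smul {n : ℕ} (a : A) (x : Γ.Form n) :
    Form.val Γ (MulOpposite.op a • x) = Form.val Γ x * Γ.base a := rfl

instance (n : ℕ) : SMulCommClass A Aᵐᵒᵖ (Γ.Form n) where
  smul_comm a b x := Form.ext Γ (by
    change Γ.base a * (Form.val Γ x * Γ.base b.unop) = Γ.base a * Form.val Γ x * Γ.base b.unop
    rw [mul_assoc])

/-- The map `A ⊗ A → Ω¹ ⊆ Ω`, `a ⊗ b ↦ a db`. -/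
def leftD : A ⊗[k] A →ₗ[k] Ω :=
  TensorProduct.lift ((LinearMap.mul k Ω).compl₁₂ Γ.base.toLinearMap (Γ.d ∘ₗ Γ.base.toLinearMap))

@[simp] theorem leftD_tmul (a b : A) : Γ.leftD (a ⊗ₜ b) = Γ.base a * Γ.d (Γ.base b) := rfl

theorem mul'_smul (a : A) (t : A ⊗[k] A) :
    LinearMap.mul' k A (a • t) = a * LinearMap.mul' k A t := by
  induction t using TensorProduct.induction_on with
  | zero => simp
  | tmul x y => simp [TensorProduct.smul_tmul', mul_assoc]
  | add s t hs ht => rw [smul_add, map_add, hs, ht, map_add, mul_add]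

theorem leftD_smul (a : A) (t : A ⊗[k] A) : Γ.leftD (a • t) = Γ.base a * Γ.leftD t := by
  induction t using TensorProduct.induction_on with
  | zero => simp
  | tmul x y => simp [TensorProduct.smul_tmul', mul_assoc]
  | add s t hs ht => rw [smul_add, map_add, hs, ht, map_add, mul_add]

/-- The relations of the `1`-jet bimodule: the kernel of `a ⊗ b ↦ a db` on the universal
`1`-forms `ker (A ⊗ A → A)`. -/
def jetRel : Submodule A (A ⊗[k] A) where
  carrier := {t | LinearMap.mul' k A t = 0 ∧ Γ.leftD t = 0}
  add_mem' {s t} hs ht := ⟨by rw [map_add, hs.1, ht.1, add_zero],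
    by rw [map_add, hs.2, ht.2, add_zero]⟩
  zero_mem' := ⟨map_zero _, map_zero _⟩
  smul_mem' a t ht := ⟨by rw [mul'_smul, ht.1, mul_zero], by rw [leftD_smul, ht.2, mul_zero]⟩

/-- The `A`-bimodule `J¹A = (A ⊗ A) / N` of `1`-jets of `A`. -/
def JetA : Type u := (A ⊗[k] A) ⧸ Γ.jetRel

instance : AddCommGroup Γ.JetA := inferInstanceAs (AddCommGroup ((A ⊗[k] A) ⧸ Γ.jetRel))

instance : Module A Γ.JetA := inferInstanceAs (Module A ((A ⊗[k] A) ⧸ Γ.jetRel))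

/-- The projection `A ⊗ A → J¹A`, `a ⊗ b ↦ [a ⊗ b]`. -/
def JetA.mk : A ⊗[k] A →ₗ[A] Γ.JetA := Γ.jetRel.mkQ

theorem JetA.mk_surjective : Function.Surjective (JetA.mk Γ) := Γ.jetRel.mkQ_surjective

/-- Multiplication by `c` on the right factor of `A ⊗ A`. -/
def rmul (k : Type w) {A : Type u} [CommRing k] [Ring A] [Algebra k A] (c : A) :
    A ⊗[k] A →ₗ[A] A ⊗[k] A :=
  TensorProduct.AlgebraTensorModule.map LinearMap.id (LinearMap.mulRight k c)

@[simp] theorem rmul_tmul (a b c : A) : rmul k c (a ⊗ₜ b) = a ⊗ₜ (b * c) := rfl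

theorem mul'_rmul (c : A) (t : A ⊗[k] A) :
    LinearMap.mul' k A (rmul k c t) = LinearMap.mul' k A t * c := by
  induction t using TensorProduct.induction_on with
  | zero => simp
  | tmul x y => simp [mul_assoc]
  | add s t hs ht => rw [map_add, map_add, hs, ht, map_add, add_mul]

theorem leftD_rmul (c : A) (t : A ⊗[k] A) : Γ.leftD (rmul k c t)
    = Γ.leftD t * Γ.base c + Γ.base (LinearMap.mul' k A t) * Γ.d (Γ.base c) := by
  induction t using TensorProduct.induction_on with
  | zero => simp
  | tmul x y =>
    rw [rmul_tmul, leftD_tmul, d_base_mul, leftD_tmul, LinearMap.mul'_apply, map_mul]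
    noncomm_ring
  | add s t hs ht => simp only [map_add, hs, ht, add_mul]; abel

theorem jetRel_le_comap (c : A) : Γ.jetRel ≤ Γ.jetRel.comap (rmul k c) := fun t ht =>
  ⟨by rw [mul'_rmul, ht.1, zero_mul], by rw [leftD_rmul, ht.1, ht.2]; simp⟩

/-- The right action of `c` on `J¹A`. -/
def JetA.rmul (c : A) : Γ.JetA →ₗ[A] Γ.JetA :=
  Γ.jetRel.mapQ Γ.jetRel (ExtAlg.rmul k c) (Γ.jetRel_le_comap c)

theorem JetA.rmul_mk (c : A) (t : A ⊗[k] A) :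
    JetA.rmul Γ c (JetA.mk Γ t) = JetA.mk Γ (ExtAlg.rmul k c t) := rfl

theorem JetA.induction {p : Γ.JetA → Prop} (h0 : p 0)
    (ht : ∀ a b : A, p (JetA.mk Γ (a ⊗ₜ b))) (ha : ∀ s t, p s → p t → p (s + t)) (t : Γ.JetA) :
    p t := by
  obtain ⟨t, rfl⟩ := JetA.mk_surjective Γ t
  induction t using TensorProduct.induction_on with
  | zero => rw [map_zero]; exact h0
  | tmul x m => exact ht x m
  | add s t hs ht => rw [map_add]; exact ha _ _ hs ht

instance : Module Aᵐᵒᵖ Γ.JetA where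
  smul c x := JetA.rmul Γ c.unop x
  one_smul x := by
    change JetA.rmul Γ 1 x = x
    induction x using JetA.induction with
    | h0 => simp
    | ht a b => simp [JetA.rmul_mk]
    | ha s t hs ht => rw [map_add, hs, ht]
  mul_smul a b x := by
    change JetA.rmul Γ (b.unop * a.unop) x = JetA.rmul Γ a.unop (JetA.rmul Γ b.unop x)
    induction x using JetA.induction with
    | h0 => simp
    | ht a b => simp [JetA.rmul_mk, mul_assoc]
    | ha s t hs ht => rw [map_add, hs, ht, map_add, map_add]
  smul_zero a := map_zero (JetA.rmul Γ a.unop)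
  smul_add a x y := map_add (JetA.rmul Γ a.unop) x y
  add_smul a b x := by
    change JetA.rmul Γ (a.unop + b.unop) x = JetA.rmul Γ a.unop x + JetA.rmul Γ b.unop x
    induction x using JetA.induction with
    | h0 => simp
    | ht a b => simp [JetA.rmul_mk, mul_add, TensorProduct.tmul_add]
    | ha s t hs ht => rw [map_add, hs, ht, map_add, map_add]; abel
  zero_smul x := by
    change JetA.rmul Γ 0 x = 0
    induction x using JetA.induction with
    | h0 => simp
    | ht a b => simp [JetA.rmul_mk]
    | ha s t hs ht => rw [map_add, hs, ht, add_zero]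

theorem JetA.op_smul_mk (c : A) (t : A ⊗[k] A) :
    MulOpposite.op c • JetA.mk Γ t = JetA.mk Γ (ExtAlg.rmul k c t) := rfl

instance : SMulCommClass A Aᵐᵒᵖ Γ.JetA where
  smul_comm a b x := ((JetA.rmul Γ b.unop).map_smul a x).symm

/-- The `1`-jet module `J¹M = J¹A ⊗_A M` of a left `A`-module `M`. -/
abbrev J1 (M : Type y) [AddCommGroup M] [Module A M] : Type (max u y) := BTensor A Γ.JetA M

/-- The `1`-jet prolongation `m ↦ [1 ⊗ 1] ⊗ m`. -/
def j1 (M : Type y) [AddCommGroup M] [Module A M] : M →+ Γ.J1 M :=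
  BTensor.mk A Γ.JetA M (JetA.mk Γ (1 ⊗ₜ 1))

variable {M : Type y} [AddCommGroup M] [Module A M]

theorem tmul_eq (a b : A) (m : M) :
    BTensor.tmul (JetA.mk Γ (a ⊗ₜ b)) m = a • Γ.j1 M (b • m) := by
  change _ = a • BTensor.tmul (JetA.mk Γ (1 ⊗ₜ 1)) (b • m)
  rw [← BTensor.op_smul_tmul, BTensor.smul_tmul, JetA.op_smul_mk, rmul_tmul, ← map_smul,
    TensorProduct.smul_tmul', one_mul, smul_eq_mul, mul_one]

theorem J1.induction {p : Γ.J1 M → Prop} (h0 : p 0) (ht : ∀ (a : A) (m : M), p (a • Γ.j1 M m))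
    (ha : ∀ s t, p s → p t → p (s + t)) (t : Γ.J1 M) : p t := by
  induction t using BTensor.induction with
  | h0 => exact h0
  | ht x m =>
    induction x using JetA.induction with
    | h0 => rw [← BTensor.mk_apply, map_zero]; exact h0
    | ht a b => rw [tmul_eq]; exact ht _ _
    | ha s t hs ht => rw [BTensor.add_tmul]; exact ha _ _ hs ht
  | ha s t hs ht => exact ha _ _ hs ht

theorem J1.hom_ext {N : Type x} [AddCommGroup N] [Module A N] {f g : Γ.J1 M →ₗ[A] N}
    (h : ∀ m, f (Γ.j1 M m) = g (Γ.j1 M m)) : f = g := by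
  ext t
  induction t using J1.induction with
  | h0 => simp
  | ht a m => rw [map_smul, map_smul, h]
  | ha s t hs ht => rw [map_add, map_add, hs, ht]

/-- The functor `J¹` on morphisms. -/
abbrev J1.map {N : Type x} [AddCommGroup N] [Module A N] (f : M →ₗ[A] N) : Γ.J1 M →ₗ[A] Γ.J1 N :=
  BTensor.map Γ.JetA f

theorem J1.map_j1 {N : Type x} [AddCommGroup N] [Module A N] (f : M →ₗ[A] N) (m : M) :
    J1.map Γ f (Γ.j1 M m) = Γ.j1 N (f m) :=
  BTensor.map_tmul f _ m

/-- The bimodule projection `J¹A → A`, `[a ⊗ b] ↦ ab`. -/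
def JetA.proj : Γ.JetA →+ A :=
  QuotientAddGroup.lift Γ.jetRel.toAddSubgroup (LinearMap.mul' k A).toAddMonoidHom
    (fun _ ht => ht.1)

@[simp] theorem JetA.proj_mk (t : A ⊗[k] A) :
    JetA.proj Γ (JetA.mk Γ t) = LinearMap.mul' k A t := rfl

theorem JetA.proj_smul (a : A) (t : Γ.JetA) : JetA.proj Γ (a • t) = a * JetA.proj Γ t := by
  obtain ⟨t, rfl⟩ := JetA.mk_surjective Γ t
  rw [← map_smul]; exact mul'_smul a t

theorem JetA.proj_op_smul (a : A) (t : Γ.JetA) :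
    JetA.proj Γ (MulOpposite.op a • t) = JetA.proj Γ t * a := by
  obtain ⟨t, rfl⟩ := JetA.mk_surjective Γ t
  exact mul'_rmul a t

/-- The additive map `J¹M → M`, `[a ⊗ b] ⊗ m ↦ abm`. -/
def projAux (M : Type y) [AddCommGroup M] [Module A M] : Γ.J1 M →+ M :=
  BTensor.lift ((smulAddHom A M).comp (JetA.proj Γ)) (fun t a m => by
    simp only [AddMonoidHom.comp_apply, smulAddHom_apply, JetA.proj_op_smul, mul_smul])

theorem projAux_tmul (t : Γ.JetA) (m : M) :
    Γ.projAux M (BTensor.tmul t m) = JetA.proj Γ t • m := by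
  rw [projAux]
  exact Eq.trans (BTensor.lift_tmul _ _ _ _) rfl

/-- The jet projection `π^{1,0} : J¹M → M`, `[a ⊗ b] ⊗ m ↦ abm`. -/
def proj (M : Type y) [AddCommGroup M] [Module A M] : Γ.J1 M →ₗ[A] M where
  toFun := Γ.projAux M
  map_add' := map_add _
  map_smul' a t := by
    induction t using BTensor.induction with
    | h0 => simp
    | ht x m =>
      rw [BTensor.smul_tmul, projAux_tmul, projAux_tmul, JetA.proj_smul, mul_smul,
        RingHom.id_apply]
    | ha s t hs ht => rw [smul_add, map_add, hs, ht, map_add, smul_add]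

theorem proj_tmul (t : Γ.JetA) (m : M) : Γ.proj M (BTensor.tmul t m) = JetA.proj Γ t • m :=
  Γ.projAux_tmul t m

@[simp] theorem proj_j1 (m : M) : Γ.proj M (Γ.j1 M m) = m := by
  change Γ.proj M (BTensor.tmul (JetA.mk Γ (1 ⊗ₜ 1)) m) = m
  rw [proj_tmul]; simp

/-- The differential `A → Ω¹`. -/
def dForm : A →+ Γ.Form 1 where
  toFun a := Form.of Γ (Γ.d (Γ.base a)) (Γ.d_mem 0 _ (Γ.base_mem a))
  map_zero' := Form.ext Γ (by simp)
  map_add' a b := Form.ext Γ (by simp)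

@[simp] theorem val_dForm (a : A) : Form.val Γ (Γ.dForm a) = Γ.d (Γ.base a) := rfl

/-- For `ω ∈ Ω`, the map `A ⊗ A → Ω`, `y ⊗ z ↦ d(ωy) z`. -/
def spencerAux (ω : Ω) : A ⊗[k] A →ₗ[k] Ω :=
  TensorProduct.lift ((LinearMap.mul k Ω).compl₁₂
    (Γ.d ∘ₗ LinearMap.mulLeft k ω ∘ₗ Γ.base.toLinearMap) Γ.base.toLinearMap)

@[simp] theorem spencerAux_tmul (ω : Ω) (y z : A) :
    Γ.spencerAux ω (y ⊗ₜ z) = Γ.d (ω * Γ.base y) * Γ.base z := rfl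

theorem spencerAux_eq {m : ℕ} {ω : Ω} (hω : ω ∈ Γ.gr m) (t : A ⊗[k] A) :
    Γ.spencerAux ω t = Γ.d ω * Γ.base (LinearMap.mul' k A t)
      + (-1) ^ m * (ω * (Γ.d (Γ.base (LinearMap.mul' k A t)) - Γ.leftD t)) := by
  induction t using TensorProduct.induction_on with
  | zero => simp
  | tmul y z =>
    rw [spencerAux_tmul, Γ.leibniz m _ _ hω, LinearMap.mul'_apply, d_base_mul, leftD_tmul, map_mul]
    simp only [add_sub_cancel_right, add_mul, mul_assoc]
  | add s t hs ht => simp only [map_add, hs, ht, mul_add, mul_sub]; abel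

theorem spencerAux_mem {m : ℕ} {ω : Ω} (hω : ω ∈ Γ.gr m) (t : A ⊗[k] A) :
    Γ.spencerAux ω t ∈ Γ.gr (m + 1) := by
  induction t using TensorProduct.induction_on with
  | zero => simp
  | tmul y z => exact Γ.mul_base_mem z (Γ.d_mem _ _ (Γ.mul_base_mem y hω))
  | add s t hs ht => rw [map_add]; exact add_mem hs ht

theorem spencerAux_eq_zero {m : ℕ} {ω : Ω} (hω : ω ∈ Γ.gr m) {t : A ⊗[k] A}
    (ht : t ∈ Γ.jetRel) : Γ.spencerAux ω t = 0 := by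
  rw [Γ.spencerAux_eq hω, ht.1, ht.2]; simp

/-- The pairing `Ωᵐ × J¹A → Ωᵐ⁺¹`, `(ω, [y ⊗ z]) ↦ d(ωy) z`. -/
def spencerPair (m : ℕ) : Γ.Form m →+ Γ.JetA →+ Γ.Form (m + 1) :=
  AddMonoidHom.mk' (fun ω => QuotientAddGroup.lift Γ.jetRel.toAddSubgroup
      (AddMonoidHom.mk' (fun t => Form.of Γ (Γ.spencerAux (Form.val Γ ω) t)
        (Γ.spencerAux_mem (Form.val_mem Γ ω) t)) (fun s t => Form.ext Γ (by simp)))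
      (fun _ ht => Form.ext Γ (by simp [Γ.spencerAux_eq_zero (Form.val_mem Γ ω) ht])))
    (fun ω ω' => by
      ext t
      obtain ⟨t, rfl⟩ := JetA.mk_surjective Γ t
      refine Form.ext Γ ?_
      change Γ.spencerAux (Form.val Γ (ω + ω')) t
        = Γ.spencerAux (Form.val Γ ω) t + Γ.spencerAux (Form.val Γ ω') t
      induction t using TensorProduct.induction_on with
      | zero => simp
      | tmul y z => simp [add_mul]
      | add s t hs ht => simp only [map_add] at hs ht ⊢; rw [hs, ht]; abel)

theorem val_spencerPair (m : ℕ) (ω : Γ.Form m) (t : A ⊗[k] A) :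
    Form.val Γ (Γ.spencerPair m ω (JetA.mk Γ t)) = Γ.spencerAux (Form.val Γ ω) t := rfl

theorem spencerPair_op_smul (m : ℕ) (ω : Γ.Form m) (c : A) (t : Γ.JetA) :
    Γ.spencerPair m ω (MulOpposite.op c • t) = MulOpposite.op c • Γ.spencerPair m ω t := by
  induction t using JetA.induction with
  | h0 => simp
  | ht a b =>
    refine Form.ext Γ ?_
    rw [JetA.op_smul_mk, val_spencerPair, Form.val_op_smul, val_spencerPair]
    simp [mul_assoc]
  | ha s t hs ht => rw [smul_add, map_add, hs, ht, map_add, smul_add]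

theorem spencerPair_balanced (m : ℕ) (ω : Γ.Form m) (a : A) (t : Γ.JetA) :
    Γ.spencerPair m (MulOpposite.op a • ω) t = Γ.spencerPair m ω (a • t) := by
  induction t using JetA.induction with
  | h0 => simp
  | ht b c =>
    refine Form.ext Γ ?_
    rw [← map_smul, val_spencerPair, val_spencerPair]
    simp [mul_assoc, TensorProduct.smul_tmul']
  | ha s t hs ht => rw [smul_add, map_add, hs, ht, map_add]

/-- The map `J¹M → Ωᵐ⁺¹ ⊗_A M`, `[y ⊗ z] ⊗ e ↦ d(ωy) z ⊗ e`, for a fixed `m`-form `ω`. -/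
def spencerFix (m : ℕ) (M : Type y) [AddCommGroup M] [Module A M] (ω : Γ.Form m) :
    Γ.J1 M →+ BTensor A (Γ.Form (m + 1)) M :=
  BTensor.lift ((BTensor.mk A (Γ.Form (m + 1)) M).comp (Γ.spencerPair m ω)) (fun t a m' => by
    simp only [AddMonoidHom.comp_apply, BTensor.mk_apply, spencerPair_op_smul,
      BTensor.op_smul_tmul])

@[simp] theorem spencerFix_tmul (m : ℕ) (ω : Γ.Form m) (t : Γ.JetA) (e : M) :
    Γ.spencerFix m M ω (BTensor.tmul t e) = BTensor.tmul (Γ.spencerPair m ω t) e := by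
  rw [spencerFix]
  exact Eq.trans (BTensor.lift_tmul _ _ _ _) rfl

/-- The Spencer operator `Ωᵐ ⊗_A J¹M → Ωᵐ⁺¹ ⊗_A M`,
`ω ⊗ [y ⊗ z] ⊗ e ↦ d(ωy) z ⊗ e`. -/
def spencer (m : ℕ) (M : Type y) [AddCommGroup M] [Module A M] :
    BTensor A (Γ.Form m) (Γ.J1 M) →+ BTensor A (Γ.Form (m + 1)) M :=
  BTensor.lift (AddMonoidHom.mk' (Γ.spencerFix m M) (fun ω ω' => by
      ext t
      induction t using BTensor.induction with
      | h0 => simp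
      | ht t e => simp [BTensor.add_tmul]
      | ha s t hs ht => rw [map_add, hs, ht, map_add]))
    (fun ω a t => by
      change Γ.spencerFix m M (MulOpposite.op a • ω) t = Γ.spencerFix m M ω (a • t)
      induction t using BTensor.induction with
      | h0 => simp
      | ht t e => rw [BTensor.smul_tmul]; simp [spencerPair_balanced]
      | ha s t hs ht => rw [map_add, hs, ht, smul_add, map_add])

theorem spencer_tmul (m : ℕ) (ω : Γ.Form m) (t : Γ.J1 M) :
    Γ.spencer m M (BTensor.tmul ω t) = Γ.spencerFix m M ω t := by
  rw [spencer, BTensor.lift_tmul]; rfl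

/-- The unit of `Ω`, as a `0`-form. -/
def oneForm : Γ.Form 0 := Form.of Γ 1 (Γ.gradedMonoid.one_mem)

/-- The Spencer operator `J¹M → Ω¹ ⊗_A M`, `[y ⊗ z] ⊗ e ↦ (dy) z ⊗ e`. -/
def spencer0 (M : Type y) [AddCommGroup M] [Module A M] :
    Γ.J1 M →+ BTensor A (Γ.Form 1) M :=
  (Γ.spencer 0 M).comp (BTensor.mk A (Γ.Form 0) (Γ.J1 M) Γ.oneForm)

theorem spencer0_smul_j1 (a : A) (m : M) :
    Γ.spencer0 M (a • Γ.j1 M m) = BTensor.tmul (Γ.dForm a) m := by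
  change Γ.spencer 0 M (BTensor.tmul Γ.oneForm (a • BTensor.tmul (JetA.mk Γ (1 ⊗ₜ 1)) m)) = _
  rw [spencer_tmul, BTensor.smul_tmul, ← map_smul, spencerFix_tmul]
  congr 1
  refine Form.ext Γ ?_
  rw [val_spencerPair]
  simp [TensorProduct.smul_tmul', oneForm]

theorem spencer0_smul (a : A) (t : Γ.J1 M) : Γ.spencer0 M (a • t)
    = a • Γ.spencer0 M t + BTensor.tmul (Γ.dForm a) (Γ.proj M t) := by
  induction t using J1.induction with
  | h0 => simp [← BTensor.mk_apply]
  | ht b m =>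
    rw [smul_smul, spencer0_smul_j1, spencer0_smul_j1, map_smul, proj_j1, BTensor.smul_tmul,
      ← BTensor.op_smul_tmul, ← BTensor.add_tmul]
    congr 1
    refine Form.ext Γ ?_
    simp only [val_dForm, map_add, Form.val_smul, Form.val_op_smul, d_base_mul]
    abel
  | ha s t hs ht => simp only [smul_add, map_add, hs, ht, BTensor.tmul_add]; abel

/-- The map `J¹A → Ω¹`, `[a ⊗ b] ↦ a db`. -/
def JetA.leftD : Γ.JetA →+ Γ.Form 1 :=
  QuotientAddGroup.lift Γ.jetRel.toAddSubgroup
    (AddMonoidHom.mk' (fun t => Form.of Γ (Γ.leftD t) (by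
        induction t using TensorProduct.induction_on with
        | zero => simp
        | tmul y z => exact Γ.base_mul_mem y (Γ.d_mem _ _ (Γ.base_mem z))
        | add s t hs ht => rw [map_add]; exact add_mem hs ht))
      (fun s t => Form.ext Γ (by simp)))
    (fun _ ht => Form.ext Γ (by simp [ht.2]))

theorem JetA.val_leftD (t : A ⊗[k] A) :
    Form.val Γ (JetA.leftD Γ (JetA.mk Γ t)) = Γ.leftD t := rfl

theorem JetA.leftD_op_smul (c : A) (t : Γ.JetA) : JetA.leftD Γ (MulOpposite.op c • t)
    = MulOpposite.op c • JetA.leftD Γ t + JetA.proj Γ t • Γ.dForm c := by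
  obtain ⟨t, rfl⟩ := JetA.mk_surjective Γ t
  exact Form.ext Γ (Γ.leftD_rmul c t)

/-- The first component `𝔇ᴵ : J¹J¹M → Ω¹ ⊗_A M`, `[a ⊗ b] ⊗ [c ⊗ f] ⊗ e ↦ a d(bc) f ⊗ e`: the
`A`-linear lift of the Spencer operator `J¹M → Ω¹ ⊗_A M`, written on `t ⊗ x` with `t = [a ⊗ b]` as
`ab S(x) + (a db) ⊗ π^{1,0}(x)`. -/
def holI (M : Type y) [AddCommGroup M] [Module A M] :
    Γ.J1 (Γ.J1 M) →+ BTensor A (Γ.Form 1) M :=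
  BTensor.lift (AddMonoidHom.mk'
      (fun t => ((smulAddHom A _) (JetA.proj Γ t)).comp (Γ.spencer0 M)
        + (BTensor.mk A (Γ.Form 1) M (JetA.leftD Γ t)).comp (Γ.proj M).toAddMonoidHom)
      (fun s t => by ext x; simp; abel))
    (fun t a x => by
      simp only [AddMonoidHom.mk'_apply, AddMonoidHom.add_apply, AddMonoidHom.comp_apply,
        smulAddHom_apply, BTensor.mk_apply, LinearMap.toAddMonoidHom_coe, JetA.proj_op_smul,
        JetA.leftD_op_smul, spencer0_smul, map_smul, BTensor.add_tmul, BTensor.op_smul_tmul,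
        smul_add, mul_smul, BTensor.smul_tmul]
      abel)

theorem holI_tmul (t : Γ.JetA) (x : Γ.J1 M) : Γ.holI M (BTensor.tmul t x)
    = JetA.proj Γ t • Γ.spencer0 M x + BTensor.tmul (JetA.leftD Γ t) (Γ.proj M x) := by
  rw [holI, BTensor.lift_tmul]; rfl

theorem holI_smul_j1 (a : A) (x : Γ.J1 M) :
    Γ.holI M (a • Γ.j1 _ x) = a • Γ.spencer0 M x := by
  change Γ.holI M (a • BTensor.tmul (JetA.mk Γ (1 ⊗ₜ 1)) x) = _
  rw [BTensor.smul_tmul, ← map_smul, holI_tmul]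
  have : JetA.leftD Γ (JetA.mk Γ (a • 1 ⊗ₜ 1)) = 0 :=
    Form.ext Γ (by rw [JetA.val_leftD]; simp [TensorProduct.smul_tmul', d_one])
  rw [this, ← BTensor.mk_apply, map_zero, AddMonoidHom.zero_apply, add_zero]
  simp [TensorProduct.smul_tmul']

/-- The explicit formula for `𝔇ᴵ`. -/
theorem holI_apply (a b c f : A) (e : M) :
    Γ.holI M (BTensor.tmul (JetA.mk Γ (a ⊗ₜ b)) (BTensor.tmul (JetA.mk Γ (c ⊗ₜ f)) e))
      = BTensor.tmul (a • MulOpposite.op f • Γ.dForm (b * c)) e := by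
  rw [tmul_eq, tmul_eq, smul_smul, holI_smul_j1, spencer0_smul_j1, BTensor.smul_tmul,
    ← BTensor.op_smul_tmul, smul_comm a (MulOpposite.op f)]

/-- The second component `𝔇ᴵᴵ : J¹J¹M → Ω² ⊗_A M`, minus the composition of two Spencer operators,
that is `[a ⊗ b] ⊗ [c ⊗ f] ⊗ e ↦ (da ∧ d(bc)) f ⊗ e`. -/
def holII (M : Type y) [AddCommGroup M] [Module A M] :
    Γ.J1 (Γ.J1 M) →+ BTensor A (Γ.Form 2) M :=
  -(Γ.spencer 1 M).comp (Γ.spencer0 (Γ.J1 M))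

/-- The product `Ω¹ × Ω¹ → Ω²`. -/
def wedge (ω η : Γ.Form 1) : Γ.Form 2 :=
  Form.of Γ (Form.val Γ ω * Form.val Γ η)
    (Γ.gradedMonoid.mul_mem (Form.val_mem Γ ω) (Form.val_mem Γ η))

/-- Left multiplication by a `1`-form, `Ω¹ ⊗_A M → Ω² ⊗_A M`. -/
def wedgeLeft (ω : Γ.Form 1) (M : Type y) [AddCommGroup M] [Module A M] :
    BTensor A (Γ.Form 1) M →+ BTensor A (Γ.Form 2) M :=
  BTensor.lift ((BTensor.mk A (Γ.Form 2) M).comp (AddMonoidHom.mk' (Γ.wedge ω)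
      (fun η η' => Form.ext Γ (by simp [wedge, mul_add]))))
    (fun η a m => by
      change BTensor.tmul (Γ.wedge ω (MulOpposite.op a • η)) m = BTensor.tmul (Γ.wedge ω η) (a • m)
      rw [← BTensor.op_smul_tmul]
      congr 1
      exact Form.ext Γ (by simp [wedge, mul_assoc]))

theorem wedgeLeft_tmul (ω η : Γ.Form 1) (m : M) :
    Γ.wedgeLeft ω M (BTensor.tmul η m) = BTensor.tmul (Γ.wedge ω η) m := by
  rw [wedgeLeft, BTensor.lift_tmul]; rfl

theorem holII_smul_j1_smul_j1 (a b : A) (m : M) : Γ.holII M (a • Γ.j1 _ (b • Γ.j1 M m))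
    = BTensor.tmul (Γ.wedge (Γ.dForm a) (Γ.dForm b)) m := by
  change -Γ.spencer 1 M (Γ.spencer0 (Γ.J1 M) (a • Γ.j1 _ (b • Γ.j1 M m))) = _
  rw [spencer0_smul_j1, spencer_tmul]
  change -Γ.spencerFix 1 M _ (b • BTensor.tmul (JetA.mk Γ (1 ⊗ₜ 1)) m) = _
  rw [BTensor.smul_tmul, ← map_smul, spencerFix_tmul, neg_eq_iff_eq_neg, ← BTensor.mk_apply,
    ← BTensor.mk_apply, ← AddMonoidHom.neg_apply, ← map_neg]
  congr 2
  refine Form.ext Γ ?_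
  rw [val_spencerPair, map_neg]
  have := Γ.leibniz 1 _ (Γ.base b) (Γ.d_mem 0 _ (Γ.base_mem a))
  simp only [d_d, zero_mul, zero_add, pow_one, neg_one_mul] at this
  simp [TensorProduct.smul_tmul', wedge, this]

/-- The explicit formula for `𝔇ᴵᴵ`. -/
theorem holII_apply (a b c f : A) (e : M) :
    Γ.holII M (BTensor.tmul (JetA.mk Γ (a ⊗ₜ b)) (BTensor.tmul (JetA.mk Γ (c ⊗ₜ f)) e))
      = BTensor.tmul (MulOpposite.op f • Γ.wedge (Γ.dForm a) (Γ.dForm (b * c))) e := by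
  rw [tmul_eq, tmul_eq, smul_smul, holII_smul_j1_smul_j1, BTensor.op_smul_tmul]

theorem J1.induction₂ {p : Γ.J1 (Γ.J1 M) → Prop} (h0 : p 0)
    (ht : ∀ (a b : A) (m : M), p (a • Γ.j1 _ (b • Γ.j1 M m)))
    (ha : ∀ s t, p s → p t → p (s + t)) (t : Γ.J1 (Γ.J1 M)) : p t := by
  induction t using J1.induction with
  | h0 => exact h0
  | ht a x =>
    induction x using J1.induction with
    | h0 => rw [map_zero, smul_zero]; exact h0
    | ht b m => exact ht a b m
    | ha s t hs ht => rw [map_add, smul_add]; exact ha _ _ hs ht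
  | ha s t hs ht => exact ha _ _ hs ht

theorem holI_smul (a : A) (x : Γ.J1 (Γ.J1 M)) : Γ.holI M (a • x) = a • Γ.holI M x := by
  induction x using J1.induction with
  | h0 => simp
  | ht b x => rw [smul_smul, holI_smul_j1, holI_smul_j1, mul_smul]
  | ha s t hs ht => rw [smul_add, map_add, hs, ht, map_add, smul_add]

theorem holII_smul (a : A) (x : Γ.J1 (Γ.J1 M)) :
    Γ.holII M (a • x) = a • Γ.holII M x + Γ.wedgeLeft (Γ.dForm a) M (Γ.holI M x) := by
  induction x using J1.induction₂ with
  | h0 => simp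
  | ht b c m =>
    rw [smul_smul, holII_smul_j1_smul_j1, holII_smul_j1_smul_j1, holI_smul_j1, spencer0_smul_j1,
      BTensor.smul_tmul, BTensor.smul_tmul, wedgeLeft_tmul, ← BTensor.add_tmul]
    congr 1
    refine Form.ext Γ ?_
    simp only [wedge, Form.val_of, val_dForm, map_add, Form.val_smul, d_base_mul, add_mul,
      mul_assoc]
    abel
  | ha s t hs ht => simp only [smul_add, map_add, hs, ht]; abel

theorem holI_natural {N : Type x} [AddCommGroup N] [Module A N] (f : M →ₗ[A] N)
    (x : Γ.J1 (Γ.J1 M)) :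
    Γ.holI N (J1.map Γ (J1.map Γ f) x) = BTensor.map _ f (Γ.holI M x) := by
  induction x using J1.induction₂ with
  | h0 => simp
  | ht a b m =>
    rw [map_smul (J1.map Γ (J1.map Γ f)), J1.map_j1, map_smul (J1.map Γ f), J1.map_j1, holI_smul_j1, spencer0_smul_j1, holI_smul_j1,
      spencer0_smul_j1, map_smul, BTensor.map_tmul]
  | ha s t hs ht => simp only [map_add, hs, ht]

theorem holII_natural {N : Type x} [AddCommGroup N] [Module A N] (f : M →ₗ[A] N)
    (x : Γ.J1 (Γ.J1 M)) :
    Γ.holII N (J1.map Γ (J1.map Γ f) x) = BTensor.map _ f (Γ.holII M x) := by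
  induction x using J1.induction₂ with
  | h0 => simp
  | ht a b m =>
    rw [map_smul (J1.map Γ (J1.map Γ f)), J1.map_j1, map_smul (J1.map Γ f), J1.map_j1, holII_smul_j1_smul_j1, holII_smul_j1_smul_j1,
      BTensor.map_tmul]
  | ha s t hs ht => simp only [map_add, hs, ht]

theorem holI_j1_j1 (m : M) : Γ.holI M (Γ.j1 _ (Γ.j1 M m)) = 0 := by
  have := Γ.holI_smul_j1 1 (Γ.j1 M m)
  rw [one_smul, one_smul] at this
  have h2 := Γ.spencer0_smul_j1 1 m
  have h3 : Γ.dForm 1 = 0 := Form.ext Γ (by simp [d_one])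
  rw [one_smul, h3, ← BTensor.mk_apply, map_zero, AddMonoidHom.zero_apply] at h2
  rw [this, h2]

theorem holII_j1_j1 (m : M) : Γ.holII M (Γ.j1 _ (Γ.j1 M m)) = 0 := by
  have := Γ.holII_smul_j1_smul_j1 1 1 m
  have h3 : Γ.wedge (Γ.dForm 1) (Γ.dForm 1) = 0 := Form.ext Γ (by simp [wedge, d_one])
  rw [one_smul, one_smul, h3, ← BTensor.mk_apply, map_zero, AddMonoidHom.zero_apply] at this
  exact this

end ExtAlg

end Calculus

section Jets

variable {k : Type w} {A : Type u} {Ω : Type v} [CommRing k] [Ring A] [Algebra k A]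
    [Ring Ω] [Algebra k Ω] (Γ : ExtAlg k A Ω)

namespace ExtAlg

/-- For `l : Q → J¹P`, the kernel of the composition of `J¹(l) : J¹Q → J¹J¹P` with
`(𝔇ᴵ, 𝔇ᴵᴵ) : J¹J¹P → (Ω¹ ⊗_A P) × (Ω² ⊗_A P)`. -/
def holonomic {P : Type x} {Q : Type y} [AddCommGroup P] [Module A P] [AddCommGroup Q] [Module A Q]
    (l : Q →ₗ[A] Γ.J1 P) : Submodule A (Γ.J1 Q) where
  carrier := {t | Γ.holI P (J1.map Γ l t) = 0 ∧ Γ.holII P (J1.map Γ l t) = 0}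
  add_mem' {s t} hs ht := ⟨by rw [map_add, map_add, hs.1, ht.1, add_zero],
    by rw [map_add, map_add, hs.2, ht.2, add_zero]⟩
  zero_mem' := ⟨by rw [map_zero, map_zero], by rw [map_zero, map_zero]⟩
  smul_mem' a t ht := ⟨by rw [map_smul, holI_smul, ht.1, smul_zero],
    by rw [map_smul, holII_smul, ht.1, ht.2, smul_zero, map_zero, add_zero]⟩

/-- The data carried along in the recursive construction of the holonomic jets of `E`: two
consecutive jet modules `prev = JⁿE` and `cur = Jⁿ⁺¹E` with the map `l : Jⁿ⁺¹E → J¹JⁿE` and the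
prolongations of order `n` and `n + 1`. -/
structure JetStage (E : Type u) [AddCommGroup E] [Module A E] where
  prev : Type u
  [prevGroup : AddCommGroup prev]
  [prevModule : Module A prev]
  cur : Type u
  [curGroup : AddCommGroup cur]
  [curModule : Module A cur]
  l : cur →ₗ[A] Γ.J1 prev
  jprev : E →+ prev
  jcur : E →+ cur
  l_jcur : ∀ e, l (jcur e) = Γ.j1 prev (jprev e)

attribute [instance] JetStage.prevGroup JetStage.prevModule JetStage.curGroup JetStage.curModule

variable (E : Type u) [AddCommGroup E] [Module A E]

/-- The initial stage: `J⁰E = E`, `J¹E`, and `l = id`. -/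
def JetStage.zero : Γ.JetStage E where
  prev := E
  cur := Γ.J1 E
  l := LinearMap.id
  jprev := AddMonoidHom.id E
  jcur := Γ.j1 E
  l_jcur _ := rfl

variable {E} in
theorem JetStage.j1_mem (S : Γ.JetStage E) (e : E) :
    Γ.j1 S.cur (S.jcur e) ∈ Γ.holonomic S.l := by
  constructor
  · rw [J1.map_j1, S.l_jcur, holI_j1_j1]
  · rw [J1.map_j1, S.l_jcur, holII_j1_j1]

variable {E} in
/-- The next stage: `Jⁿ⁺²E` is the kernel of `(𝔇ᴵ, 𝔇ᴵᴵ) ∘ J¹(l)` on `J¹Jⁿ⁺¹E`. -/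
def JetStage.succ (S : Γ.JetStage E) : Γ.JetStage E where
  prev := S.cur
  cur := ↥(Γ.holonomic S.l)
  l := (Γ.holonomic S.l).subtype
  jprev := S.jcur
  jcur := AddMonoidHom.mk' (fun e => ⟨Γ.j1 S.cur (S.jcur e), S.j1_mem Γ e⟩)
    (fun e e' => Subtype.ext (by simp))
  l_jcur _ := rfl

/-- The stages of the construction. -/
def jetStage : ℕ → Γ.JetStage E
  | 0 => JetStage.zero Γ E
  | n + 1 => (jetStage n).succ

/-- The holonomic `n`-jet module `JⁿE`. -/
def Jet (n : ℕ) : Type u := (Γ.jetStage E n).prev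

instance (n : ℕ) : AddCommGroup (Γ.Jet E n) := inferInstanceAs (AddCommGroup (Γ.jetStage E n).prev)

instance (n : ℕ) : Module A (Γ.Jet E n) := inferInstanceAs (Module A (Γ.jetStage E n).prev)

/-- The `n`-jet prolongation `jⁿ : E → JⁿE`. -/
def jet (n : ℕ) : E →+ Γ.Jet E n := (Γ.jetStage E n).jprev

variable {E} in
/-- The jet projection `π^{n+1,n} = π^{1,0} ∘ l : Jⁿ⁺¹E → JⁿE`. -/
def JetStage.proj (S : Γ.JetStage E) : S.cur →ₗ[A] S.prev := Γ.proj S.prev ∘ₗ S.l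

variable {E} in
theorem JetStage.proj_jcur (S : Γ.JetStage E) (e : E) : S.proj Γ (S.jcur e) = S.jprev e := by
  change Γ.proj S.prev (S.l (S.jcur e)) = _
  rw [S.l_jcur, proj_j1]

/-- The jet projection `π^{n+1,n} : Jⁿ⁺¹E → JⁿE`. -/
def jetProj (n : ℕ) : Γ.Jet E (n + 1) →ₗ[A] Γ.Jet E n := (Γ.jetStage E n).proj Γ

theorem jetProj_jet (n : ℕ) (e : E) : Γ.jetProj E n (Γ.jet E (n + 1) e) = Γ.jet E n e :=
  (Γ.jetStage E n).proj_jcur Γ e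

variable {E} in
/-- A pair of maps between two stages that is compatible with the maps `l` and that covers
`Δ : E → F` along the prolongations. -/
def JetStage.Prolongs {F : Type u} [AddCommGroup F] [Module A F] (Δ : E → F)
    (S : Γ.JetStage E) (T : Γ.JetStage F) : Prop :=
  ∃ (g : S.prev →ₗ[A] T.prev) (g' : S.cur →ₗ[A] T.cur),
    (∀ e, g (S.jprev e) = T.jprev (Δ e)) ∧ (∀ e, g' (S.jcur e) = T.jcur (Δ e)) ∧
    ∀ t, T.l (g' t) = J1.map Γ g (S.l t)

variable {E} in
theorem JetStage.Prolongs.succ {F : Type u} [AddCommGroup F] [Module A F] {Δ : E → F}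
    {S : Γ.JetStage E} {T : Γ.JetStage F} (h : JetStage.Prolongs Γ Δ S T) :
    JetStage.Prolongs Γ Δ S.succ T.succ := by
  obtain ⟨g, g', -, hg', hl⟩ := h
  have hmap : ∀ t, J1.map Γ T.l (J1.map Γ g' t) = J1.map Γ (J1.map Γ g) (J1.map Γ S.l t) := by
    intro t
    have h : J1.map Γ T.l ∘ₗ J1.map Γ g' = J1.map Γ (J1.map Γ g) ∘ₗ J1.map Γ S.l :=
      J1.hom_ext Γ (fun e => by simp only [LinearMap.comp_apply, J1.map_j1, hl])
    exact LinearMap.congr_fun h t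
  have hmem : ∀ t : ↥(Γ.holonomic S.l), J1.map Γ g' t ∈ Γ.holonomic T.l := by
    intro t
    constructor
    · rw [hmap, holI_natural, t.2.1, map_zero]
    · rw [hmap, holII_natural, t.2.2, map_zero]
  refine ⟨g', LinearMap.codRestrict (Γ.holonomic T.l)
    (J1.map Γ g' ∘ₗ (Γ.holonomic S.l).subtype) hmem, hg', fun e => ?_, fun t => rfl⟩
  refine Subtype.ext ?_
  change J1.map Γ g' (Γ.j1 S.cur (S.jcur e)) = Γ.j1 T.cur (T.jcur (Δ e))
  rw [J1.map_j1, hg']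

/-- An `A`-linear map `f : JⁿE → F` prolongs to `Jⁿ⁺ᵐE → JᵐF`. -/
theorem exists_prolongation {F : Type u} [AddCommGroup F] [Module A F] (n : ℕ)
    (f : Γ.Jet E n →ₗ[A] F) (m : ℕ) :
    ∃ g : Γ.Jet E (n + m) →ₗ[A] Γ.Jet F m,
      ∀ e, g (Γ.jet E (n + m) e) = Γ.jet F m (f (Γ.jet E n e)) := by
  have key : JetStage.Prolongs Γ (fun e => f (Γ.jet E n e)) (Γ.jetStage E (n + m))
      (Γ.jetStage F m) := by
    induction m with
    | zero =>
      refine ⟨f, J1.map Γ f ∘ₗ (Γ.jetStage E n).l, fun e => rfl, fun e => ?_, fun t => rfl⟩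
      change J1.map Γ f ((Γ.jetStage E n).l ((Γ.jetStage E n).jcur e)) = Γ.j1 F _
      rw [JetStage.l_jcur]
      exact J1.map_j1 Γ f _
    | succ m ih => exact ih.succ
  obtain ⟨g, -, hg, -⟩ := key
  exact ⟨g, hg⟩

end ExtAlg

end Jets

section Operators

variable {k : Type w} {A : Type u} {Ω : Type v} [CommRing k] [Ring A] [Algebra k A]
    [Ring Ω] [Algebra k Ω] (Γ : ExtAlg k A Ω)
    (E : Type u) [AddCommGroup E] [Module k E] [Module A E] [IsScalarTower k A E]
    (F : Type u) [AddCommGroup F] [Module k F] [Module A F] [IsScalarTower k A F]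
    (G : Type u) [AddCommGroup G] [Module k G] [Module A G] [IsScalarTower k A G]

namespace ExtAlg

/-- The linear differential operators `E → F` of order at most `n`: the `k`-linear maps that factor
as `Δ̃ ∘ jⁿ` with `Δ̃ : JⁿE → F` an `A`-linear map. -/
def Diff (n : ℕ) : Submodule k (E →ₗ[k] F) where
  carrier := {Δ | ∃ Δ' : Γ.Jet E n →ₗ[A] F, ∀ e, Δ' (Γ.jet E n e) = Δ e}
  add_mem' := by
    rintro Δ₁ Δ₂ ⟨f, hf⟩ ⟨g, hg⟩
    exact ⟨f + g, fun e => by simp [hf, hg]⟩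
  zero_mem' := ⟨0, fun e => rfl⟩
  smul_mem' := by
    rintro c Δ ⟨f, hf⟩
    refine ⟨(c • LinearMap.id : F →ₗ[A] F) ∘ₗ f, fun e => by simp [hf]⟩

theorem Diff_le_succ (n : ℕ) : Γ.Diff E F n ≤ Γ.Diff E F (n + 1) := by
  rintro Δ ⟨f, hf⟩
  exact ⟨f ∘ₗ Γ.jetProj E n, fun e => by rw [LinearMap.comp_apply, jetProj_jet, hf]⟩

theorem Diff_mono {n m : ℕ} (h : n ≤ m) : Γ.Diff E F n ≤ Γ.Diff E F m :=
  monotone_nat_of_le_succ (Γ.Diff_le_succ E F) h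

variable {E F G} in
theorem comp_mem_Diff {n m : ℕ} {Δ₂ : F →ₗ[k] G} {Δ₁ : E →ₗ[k] F} (h₂ : Δ₂ ∈ Γ.Diff F G n)
    (h₁ : Δ₁ ∈ Γ.Diff E F m) : Δ₂ ∘ₗ Δ₁ ∈ Γ.Diff E G (n + m) := by
  obtain ⟨f₂, hf₂⟩ := h₂
  obtain ⟨f₁, hf₁⟩ := h₁
  obtain ⟨g, hg⟩ := Γ.exists_prolongation E m f₁ n
  rw [add_comm n m]
  exact ⟨f₂ ∘ₗ g, fun e => by simp [hg, hf₁, hf₂]⟩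

variable {E F} in
/-- An `A`-linear map is a differential operator of order at most `0`. -/
theorem linear_mem_Diff (φ : E →ₗ[A] F) {Δ : E →ₗ[k] F} (h : ∀ e, Δ e = φ e) :
    Δ ∈ Γ.Diff E F 0 :=
  ⟨φ, fun e => (h e).symm⟩

/-- The differential operators of order strictly less than `n`. -/
def DiffLT : ℕ → Submodule k (E →ₗ[k] F)
  | 0 => ⊥
  | n + 1 => Γ.Diff E F n

/-- The module of symbols of order `n`, `Diffⁿ(E, F) / Diffⁿ⁻¹(E, F)` (with `Diff⁻¹ = 0`). -/
def Symb (n : ℕ) : Type u :=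
  ↥(Γ.Diff E F n) ⧸ (Γ.DiffLT E F n).submoduleOf (Γ.Diff E F n)

instance (n : ℕ) : AddCommGroup (Γ.Symb E F n) :=
  inferInstanceAs (AddCommGroup (↥(Γ.Diff E F n) ⧸ (Γ.DiffLT E F n).submoduleOf (Γ.Diff E F n)))

instance (n : ℕ) : Module k (Γ.Symb E F n) :=
  inferInstanceAs (Module k (↥(Γ.Diff E F n) ⧸ (Γ.DiffLT E F n).submoduleOf (Γ.Diff E F n)))

/-- The symbol projection `ςⁿ : Diffⁿ(E, F) → Symbⁿ(E, F)`. -/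
def symb (n : ℕ) : ↥(Γ.Diff E F n) →ₗ[k] Γ.Symb E F n :=
  ((Γ.DiffLT E F n).submoduleOf (Γ.Diff E F n)).mkQ

theorem symb_surjective (n : ℕ) : Function.Surjective (Γ.symb E F n) :=
  Submodule.mkQ_surjective _

theorem symb_eq_zero_iff (n : ℕ) (Δ : ↥(Γ.Diff E F n)) :
    Γ.symb E F n Δ = 0 ↔ (Δ : E →ₗ[k] F) ∈ Γ.DiffLT E F n :=
  Submodule.Quotient.mk_eq_zero _

/-- The symbols of all orders, `Symb•(E, F) = ⨁ₙ Symbⁿ(E, F)`. -/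
abbrev SymbAll : Type u := ⨁ n, Γ.Symb E F n

variable {E F} in
theorem comp_mem_DiffLT_left {φ : F →ₗ[k] G} (hφ : φ ∈ Γ.Diff F G 0) {n : ℕ} {Δ : E →ₗ[k] F}
    (h : Δ ∈ Γ.DiffLT E F n) : φ ∘ₗ Δ ∈ Γ.DiffLT E G n := by
  cases n with
  | zero =>
    rw [DiffLT, Submodule.mem_bot] at h ⊢
    rw [h, LinearMap.comp_zero]
  | succ n =>
    have := Γ.comp_mem_Diff hφ h
    rwa [zero_add] at this

/-- The action of `φ ∈ _AHom(F, F)` on `Diffⁿ(E, F)`, `Δ ↦ φ ∘ Δ`. -/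
def postDiff (φ : F →ₗ[A] F) (n : ℕ) : ↥(Γ.Diff E F n) →ₗ[k] ↥(Γ.Diff E F n) :=
  (LinearMap.compRight k (M := E) (φ.restrictScalars k)).restrict (fun Δ hΔ => by
    have := Γ.comp_mem_Diff (Γ.linear_mem_Diff (Δ := φ.restrictScalars k) φ (fun _ => rfl)) hΔ
    rwa [zero_add] at this)

theorem coe_postDiff (φ : F →ₗ[A] F) (n : ℕ) (Δ : ↥(Γ.Diff E F n)) :
    (Γ.postDiff E F φ n Δ : E →ₗ[k] F) = φ.restrictScalars k ∘ₗ (Δ : E →ₗ[k] F) := rfl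

/-- The action of `φ ∈ _AHom(F, F)` on `Symbⁿ(E, F)`, `ςⁿ(Δ) ↦ ςⁿ(φ ∘ Δ)`. -/
def postSymb (φ : F →ₗ[A] F) (n : ℕ) : Γ.Symb E F n →ₗ[k] Γ.Symb E F n :=
  Submodule.mapQ _ _ (Γ.postDiff E F φ n) (fun _ hΔ =>
    Γ.comp_mem_DiffLT_left F (Γ.linear_mem_Diff (Δ := φ.restrictScalars k) φ (fun _ => rfl)) hΔ)

theorem postSymb_symb (φ : F →ₗ[A] F) (n : ℕ) (Δ : ↥(Γ.Diff E F n)) :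
    Γ.postSymb E F φ n (Γ.symb E F n Δ) = Γ.symb E F n (Γ.postDiff E F φ n Δ) := rfl

/-- The algebra `Diff(E, E)` of linear differential operators of finite order, under
composition. -/
def DiffAlg : Subalgebra k (Module.End k E) where
  carrier := {Δ | ∃ n, Δ ∈ Γ.Diff E E n}
  mul_mem' := by
    rintro Δ₁ Δ₂ ⟨n, h₁⟩ ⟨m, h₂⟩
    exact ⟨n + m, Γ.comp_mem_Diff h₁ h₂⟩
  add_mem' := by
    rintro Δ₁ Δ₂ ⟨n, h₁⟩ ⟨m, h₂⟩
    exact ⟨max n m, add_mem (Γ.Diff_mono E E (le_max_left n m) h₁)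
      (Γ.Diff_mono E E (le_max_right n m) h₂)⟩
  algebraMap_mem' c := ⟨0, Γ.linear_mem_Diff (c • LinearMap.id) (fun _ => rfl)⟩

/-- The inclusion `Diffⁿ(E, E) → Diff(E, E)`. -/
def toDiffAlg (n : ℕ) : ↥(Γ.Diff E E n) →ₗ[k] ↥(Γ.DiffAlg E) where
  toFun Δ := ⟨Δ, n, Δ.2⟩
  map_add' _ _ := rfl
  map_smul' _ _ := rfl

@[simp] theorem coe_toDiffAlg (n : ℕ) (Δ : ↥(Γ.Diff E E n)) :
    (Γ.toDiffAlg E n Δ : E →ₗ[k] E) = Δ := rfl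

/-- Composition `Diffⁿ(E, E) × Diffᵐ(E, E) → Diffⁿ⁺ᵐ(E, E)`, `(Δ₁, Δ₂) ↦ Δ₁ ∘ Δ₂`. -/
def compDiff (n m : ℕ) :
    ↥(Γ.Diff E E n) →ₗ[k] ↥(Γ.Diff E E m) →ₗ[k] ↥(Γ.Diff E E (n + m)) :=
  LinearMap.mk₂ k (fun Δ₁ Δ₂ => ⟨(Δ₁ : E →ₗ[k] E) ∘ₗ (Δ₂ : E →ₗ[k] E),
      Γ.comp_mem_Diff Δ₁.2 Δ₂.2⟩)
    (fun _ _ _ => Subtype.ext (LinearMap.add_comp _ _ _))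
    (fun _ _ _ => Subtype.ext (LinearMap.smul_comp _ _ _))
    (fun _ _ _ => Subtype.ext (LinearMap.comp_add _ _ _))
    (fun _ _ _ => Subtype.ext (LinearMap.comp_smul _ _ _))

@[simp] theorem coe_compDiff (n m : ℕ) (Δ₁ : ↥(Γ.Diff E E n)) (Δ₂ : ↥(Γ.Diff E E m)) :
    (Γ.compDiff E n m Δ₁ Δ₂ : E →ₗ[k] E) = (Δ₁ : E →ₗ[k] E) ∘ₗ (Δ₂ : E →ₗ[k] E) := rfl

variable {E} in
theorem comp_mem_DiffLT_of_left {n m : ℕ} {Δ₁ Δ₂ : E →ₗ[k] E} (h₁ : Δ₁ ∈ Γ.DiffLT E E n)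
    (h₂ : Δ₂ ∈ Γ.Diff E E m) : Δ₁ ∘ₗ Δ₂ ∈ Γ.DiffLT E E (n + m) := by
  cases n with
  | zero =>
    rw [DiffLT, Submodule.mem_bot] at h₁
    rw [h₁, LinearMap.zero_comp]
    exact zero_mem _
  | succ n =>
    rw [Nat.succ_add_eq_add_succ]
    exact Γ.comp_mem_Diff h₁ h₂

variable {E} in
theorem comp_mem_DiffLT_of_right {n m : ℕ} {Δ₁ Δ₂ : E →ₗ[k] E} (h₁ : Δ₁ ∈ Γ.Diff E E n)
    (h₂ : Δ₂ ∈ Γ.DiffLT E E m) : Δ₁ ∘ₗ Δ₂ ∈ Γ.DiffLT E E (n + m) := by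
  cases m with
  | zero =>
    rw [DiffLT, Submodule.mem_bot] at h₂
    rw [h₂, LinearMap.comp_zero]
    exact zero_mem _
  | succ m => exact Γ.comp_mem_Diff h₁ h₂

/-- The symbol multiplication on homogeneous elements, `ςⁿ(Δ₁) · ςᵐ(Δ₂) = ςⁿ⁺ᵐ(Δ₁ ∘ Δ₂)`. -/
def symbMulHom (n m : ℕ) :
    Γ.Symb E E n →ₗ[k] Γ.Symb E E m →ₗ[k] Γ.Symb E E (n + m) :=
  Submodule.liftQ _
    (LinearMap.flip (Submodule.liftQ _
      (LinearMap.flip ((Γ.compDiff E n m).compr₂ (Γ.symb E E (n + m))))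
      (fun Δ₂ h₂ => LinearMap.mem_ker.2 (LinearMap.ext fun Δ₁ =>
        (Γ.symb_eq_zero_iff E E _ _).2 (Γ.comp_mem_DiffLT_of_right Δ₁.2 h₂)))))
    (fun Δ₁ h₁ => LinearMap.mem_ker.2 (LinearMap.ext fun b => by
      obtain ⟨Δ₂, rfl⟩ := Γ.symb_surjective E E m b
      exact (Γ.symb_eq_zero_iff E E _ _).2 (Γ.comp_mem_DiffLT_of_left h₁ Δ₂.2)))

theorem symbMulHom_symb (n m : ℕ) (Δ₁ : ↥(Γ.Diff E E n)) (Δ₂ : ↥(Γ.Diff E E m)) :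
    Γ.symbMulHom E n m (Γ.symb E E n Δ₁) (Γ.symb E E m Δ₂)
      = Γ.symb E E (n + m) (Γ.compDiff E n m Δ₁ Δ₂) := rfl

/-- The bilinear operation on `Symb•(E, E)` with given values on pairs of homogeneous elements. -/
def gradedBilin (f : ∀ n m, Γ.Symb E E n →ₗ[k] Γ.Symb E E m →ₗ[k] Γ.SymbAll E E) :
    Γ.SymbAll E E →ₗ[k] Γ.SymbAll E E →ₗ[k] Γ.SymbAll E E :=
  DirectSum.toModule k ℕ (Γ.SymbAll E E →ₗ[k] Γ.SymbAll E E) (fun n =>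
    LinearMap.flip (DirectSum.toModule k ℕ (Γ.Symb E E n →ₗ[k] Γ.SymbAll E E)
      (fun m => LinearMap.flip (f n m))))

theorem gradedBilin_lof (f : ∀ n m, Γ.Symb E E n →ₗ[k] Γ.Symb E E m →ₗ[k] Γ.SymbAll E E)
    (n m : ℕ) (a : Γ.Symb E E n) (b : Γ.Symb E E m) :
    Γ.gradedBilin E f (DirectSum.lof k ℕ (Γ.Symb E E) n a) (DirectSum.lof k ℕ (Γ.Symb E E) m b)
      = f n m a b := by
  rw [gradedBilin, DirectSum.toModule_lof, LinearMap.flip_apply, DirectSum.toModule_lof,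
    LinearMap.flip_apply]

/-- The multiplication of the symbol algebra `Symb•(E, E)`. -/
def symbMul : Γ.SymbAll E E →ₗ[k] Γ.SymbAll E E →ₗ[k] Γ.SymbAll E E :=
  Γ.gradedBilin E (fun n m =>
    (Γ.symbMulHom E n m).compr₂ (DirectSum.lof k ℕ (Γ.Symb E E) (n + m)))

/-- The unit `id_E ∈ _AHom(E, E) = Symb⁰(E, E)` of the symbol algebra. -/
def symbOne : Γ.SymbAll E E :=
  DirectSum.lof k ℕ (Γ.Symb E E) 0
    (Γ.symb E E 0 ⟨LinearMap.id, Γ.linear_mem_Diff LinearMap.id (fun _ => rfl)⟩)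

/-- A (full) quantization for `(E, F)`: for every `n`, an `_AHom(F, F)`-linear section `qⁿ` of the
symbol projection `ςⁿ : Diffⁿ(E, F) → Symbⁿ(E, F)`. -/
structure Quantization where
  /-- the `n`-quantizations -/
  q : ∀ n, Γ.Symb E F n →ₗ[k] ↥(Γ.Diff E F n)
  symb_q : ∀ n (σ : Γ.Symb E F n), Γ.symb E F n (q n σ) = σ
  q_post : ∀ n (φ : F →ₗ[A] F) (σ : Γ.Symb E F n),
    q n (Γ.postSymb E F φ n σ) = Γ.postDiff E F φ n (q n σ)

namespace Quantization

variable {E F} {Γ} (q : Γ.Quantization E F) (p : Γ.Quantization E E)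

/-- `Δ ↦ Δ - qᵏ⁺¹(ςᵏ⁺¹(Δ))`, from operators of order at most `k + 1` to operators of order at
most `k`. -/
def step (i : ℕ) : ↥(Γ.Diff E F (i + 1)) →ₗ[k] ↥(Γ.Diff E F i) :=
  LinearMap.codRestrict (Γ.Diff E F i)
    ((Γ.Diff E F (i + 1)).subtype ∘ₗ (LinearMap.id - q.q (i + 1) ∘ₗ Γ.symb E F (i + 1)))
    (fun Δ => (Γ.symb_eq_zero_iff E F (i + 1) _).1 (by
      simp only [LinearMap.sub_apply, LinearMap.comp_apply, LinearMap.id_apply, map_sub, q.symb_q,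
        sub_self]))

theorem coe_step (i : ℕ) (Δ : ↥(Γ.Diff E F (i + 1))) : (q.step i Δ : E →ₗ[k] F)
    = (Δ : E →ₗ[k] F) - (q.q (i + 1) (Γ.symb E F (i + 1) Δ) : E →ₗ[k] F) := rfl

/-- The `i`-truncation of an operator `Δ` of order at most `n`: it is `Δ` for `i ≥ n`, and
recursively `T - qⁱ⁺¹(ςⁱ⁺¹(T))` for `i < n`, where `T` is the `(i+1)`-truncation of `Δ`. -/
def trunc (n i : ℕ) : ↥(Γ.Diff E F n) →ₗ[k] ↥(Γ.Diff E F i) :=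
  if h : n ≤ i then Submodule.inclusion (Γ.Diff_mono E F h)
  else q.step i ∘ₗ trunc n (i + 1)
termination_by n - i

/-- `[Δ]ⁱ`, the `i`-symbol of the `i`-truncation of an operator of order at most `n`. -/
def part (n i : ℕ) : ↥(Γ.Diff E F n) →ₗ[k] Γ.Symb E F i := Γ.symb E F i ∘ₗ q.trunc n i

/-- The full quantization `q = ∑ₙ qⁿ : Symb•(E, E) → Diff(E, E)`. -/
def full : Γ.SymbAll E E →ₗ[k] ↥(Γ.DiffAlg E) :=
  DirectSum.toModule k ℕ ↥(Γ.DiffAlg E) (fun n => Γ.toDiffAlg E n ∘ₗ p.q n)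

/-- The map `Δ ↦ ∑_{i ≤ N} ħⁱ [Δ]^{N-i}` on operators of order at most `N`. -/
def deform (ħ : k) (N : ℕ) : ↥(Γ.Diff E E N) →ₗ[k] Γ.SymbAll E E :=
  ∑ i ∈ Finset.range (N + 1),
    ħ ^ i • (DirectSum.lof k ℕ (Γ.Symb E E) (N - i) ∘ₗ p.part N (N - i))

/-- The star product `⋆_ħ` on `Symb•(E, E)`: the bilinear operation with
`a ⋆_ħ b = ∑_{i ≤ n+m} ħⁱ [qⁿ(a) ∘ qᵐ(b)]^{n+m-i}` for `a` of degree `n` and `b` of degree `m`. -/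
def star (ħ : k) : Γ.SymbAll E E →ₗ[k] Γ.SymbAll E E →ₗ[k] Γ.SymbAll E E :=
  Γ.gradedBilin E (fun n m =>
    ((Γ.compDiff E n m).compr₂ (p.deform ħ (n + m))).compl₁₂ (p.q n) (p.q m))

theorem star_lof (ħ : k) (n m : ℕ) (a : Γ.Symb E E n) (b : Γ.Symb E E m) :
    p.star ħ (DirectSum.lof k ℕ (Γ.Symb E E) n a) (DirectSum.lof k ℕ (Γ.Symb E E) m b)
      = ∑ i ∈ Finset.range (n + m + 1), ħ ^ i • DirectSum.lof k ℕ (Γ.Symb E E) (n + m - i)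
          (p.part (n + m) (n + m - i) (Γ.compDiff E n m (p.q n a) (p.q m b))) := by
  rw [star, gradedBilin_lof]
  simp [deform]

end Quantization

end ExtAlg

end Operators

end NCDiff

end

/-!
Both claims hold for any filtered algebra whose symbol maps are split by linear maps. An element of
order at most `N + 1` differs from the quantization of its leading symbol by an element of order at
most `N`, so `Δ ↦ ∑ ħᵏ [Δ]^{N-k}` is computed by peeling off leading symbols, each new step carrying
one more factor `ħ`. At `ħ = 1` quantizing the peeled symbols restores `Δ`, which makes `⋆₁` the
transported product and `q` surjective; at `ħ = 0` only the leading symbol survives. The map `q` is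
injective because the top component of `σ` is the symbol of `q(σ)`.
-/

noncomputable section

open scoped DirectSum

namespace NCDiff

section FiltrationProducts

variable {ι : Type*} [AddMonoid ι] [PartialOrder ι]
  {k : Type*} {B : Type*} [CommSemiring k] [Semiring B] [Algebra k B]
  {D DLT : ι → Submodule k B} [IsRingFiltration D DLT]

theorem filtrationLT_mul_mem [AddRightStrictMono ι] {i j : ι} {x y : B} (hx : x ∈ DLT i)
    (hy : y ∈ D j) : x * y ∈ DLT (i + j) := by
  have h : DLT i ≤ (DLT (i + j)).comap (LinearMap.mulRight k y) :=
    IsFiltration.is_sup (F := D) _ i fun l hl z hz =>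
      IsFiltration.is_le (F := D) (add_lt_add_left hl j) (SetLike.mul_mem_graded hz hy)
  exact h hx

theorem mul_filtrationLT_mem [AddLeftStrictMono ι] {i j : ι} {x y : B} (hx : x ∈ D i)
    (hy : y ∈ DLT j) : x * y ∈ DLT (i + j) := by
  have h : DLT j ≤ (DLT (i + j)).comap (LinearMap.mulLeft k x) :=
    IsFiltration.is_sup (F := D) _ j fun l hl z hz =>
      IsFiltration.is_le (F := D) (add_lt_add_right hl i) (SetLike.mul_mem_graded hx hz)
  exact h hy

end FiltrationProducts

/-- A filtration `D` together with symbol maps `D i → S i` whose kernels are the elements `DLT i`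
of lower order, and linear sections `quant i` of them: the data of a full quantization. The symbol
modules `S i` are arbitrary models of the quotients `D i / DLT i`. -/
structure SplitFiltration {ι k M : Type*} [CommRing k] [AddCommGroup M] [Module k M]
    (D DLT : ι → Submodule k M) (S : ι → Type*) [∀ i, AddCommGroup (S i)]
    [∀ i, Module k (S i)] where
  symb : ∀ i, D i →ₗ[k] S i
  symb_eq_zero_iff : ∀ i (x : D i), symb i x = 0 ↔ (x : M) ∈ DLT i
  quant : ∀ i, S i →ₗ[k] D i
  symb_quant : ∀ i (σ : S i), symb i (quant i σ) = σ

namespace SplitFiltration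

section Symbols

variable {ι k M : Type*} [CommRing k] [AddCommGroup M] [Module k M]
  {D DLT : ι → Submodule k M} {S : ι → Type*} [∀ i, AddCommGroup (S i)] [∀ i, Module k (S i)]
  (s : SplitFiltration D DLT S)

theorem symb_eq_symb_iff {i : ι} {x y : D i} :
    s.symb i x = s.symb i y ↔ (x - y : M) ∈ DLT i := by
  rw [← sub_eq_zero, ← map_sub, s.symb_eq_zero_iff, Submodule.coe_sub]

theorem sub_quant_symb_mem {i : ι} (x : D i) : (x - s.quant i (s.symb i x) : M) ∈ DLT i :=
  s.symb_eq_symb_iff.1 (s.symb_quant i _).symm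

/-- The full quantization `∑ᵢ quant i : ⨁ᵢ S i → M`. -/
def total [DecidableEq ι] : (⨁ i, S i) →ₗ[k] M :=
  DirectSum.toModule k ι M fun i => (D i).subtype ∘ₗ s.quant i

@[simp]
theorem total_lof [DecidableEq ι] (i : ι) (σ : S i) :
    s.total (DirectSum.lof k ι S i σ) = s.quant i σ :=
  DirectSum.toModule_lof ..

theorem total_eq_sum [DecidableEq ι] [∀ i (σ : S i), Decidable (σ ≠ 0)] (σ : ⨁ i, S i) :
    s.total σ = ∑ i ∈ DFinsupp.support σ, (s.quant i (σ i) : M) := by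
  conv_lhs => rw [← DirectSum.sum_support_of σ, map_sum]
  exact Finset.sum_congr rfl fun i _ => s.total_lof i (σ i)

theorem total_injective [LinearOrder ι] [IsFiltration D DLT] : Function.Injective s.total := by
  classical
  refine (injective_iff_map_eq_zero _).2 fun σ hσ => ?_
  by_contra hne
  have hsupp : (DFinsupp.support σ).Nonempty :=
    Finset.nonempty_iff_ne_empty.2 (mt DFinsupp.support_eq_empty.1 hne)
  set n := (DFinsupp.support σ).max' hsupp
  have hn : n ∈ DFinsupp.support σ := Finset.max'_mem _ hsupp
  have lower : ∑ i ∈ (DFinsupp.support σ).erase n, (s.quant i (σ i) : M) ∈ DLT n :=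
    sum_mem fun i hi => IsFiltration.is_le (F := D)
      ((Finset.le_max' _ i (Finset.mem_of_mem_erase hi)).lt_of_ne (Finset.ne_of_mem_erase hi))
      (s.quant i (σ i)).2
  have top : (s.quant n (σ n) : M) ∈ DLT n := by
    rw [s.total_eq_sum, ← Finset.add_sum_erase _ _ hn] at hσ
    rw [eq_neg_of_add_eq_zero_left hσ]
    exact neg_mem lower
  refine DFinsupp.mem_support_iff.1 hn ?_
  rw [← s.symb_quant n (σ n), s.symb_eq_zero_iff]
  exact top

end Symbols

section NatIndexed

variable {k M : Type*} [CommRing k] [AddCommGroup M] [Module k M]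
  {D DLT : ℕ → Submodule k M} [IsFiltration D DLT]
  {S : ℕ → Type*} [∀ n, AddCommGroup (S n)] [∀ n, Module k (S n)]
  (s : SplitFiltration D DLT S)

theorem quant_zero_symb (x : D 0) : s.quant 0 (s.symb 0 x) = x := by
  have h : (x - s.quant 0 (s.symb 0 x) : M) ∈ (⊥ : Submodule k M) :=
    IsFiltration.is_sup (F := D) ⊥ 0 (fun i hi => absurd hi i.not_lt_zero) (s.sub_quant_symb_mem x)
  exact (Subtype.ext (sub_eq_zero.1 ((Submodule.mem_bot k).1 h))).symm

/-- The remainder `x - q(ς(x))`, of lower order than `x`. -/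
def remainder (n : ℕ) : D (n + 1) →ₗ[k] D n :=
  ((D (n + 1)).subtype ∘ₗ (LinearMap.id - s.quant (n + 1) ∘ₗ s.symb (n + 1))).codRestrict (D n)
    fun x => IsFiltration.is_sup (F := D) (D n) (n + 1)
      (fun _ hi => IsFiltration.mono (Nat.lt_succ_iff.1 hi)) (s.sub_quant_symb_mem x)

theorem coe_remainder (n : ℕ) (x : D (n + 1)) :
    (s.remainder n x : M) = x - s.quant (n + 1) (s.symb (n + 1) x) :=
  rfl

/-- The map `x ↦ ∑ᵢ ħⁱ [x]^{N-i}` on elements of order at most `N`, where `[x]ⁱ` are the successive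
leading symbols of `x` and its remainders. -/
def deform (ħ : k) : ∀ N, D N →ₗ[k] ⨁ n, S n
  | 0 => DirectSum.lof k ℕ S 0 ∘ₗ s.symb 0
  | N + 1 => DirectSum.lof k ℕ S (N + 1) ∘ₗ s.symb (N + 1) + ħ • deform ħ N ∘ₗ s.remainder N

theorem deform_zero_left (N : ℕ) : s.deform 0 N = DirectSum.lof k ℕ S N ∘ₗ s.symb N := by
  cases N with
  | zero => rfl
  | succ N => rw [deform, zero_smul, add_zero]

theorem total_deform_one (N : ℕ) (x : D N) : s.total (s.deform 1 N x) = x := by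
  induction N with
  | zero => rw [deform, LinearMap.comp_apply, total_lof, quant_zero_symb]
  | succ N ih =>
    simp only [deform, one_smul, LinearMap.add_apply, LinearMap.comp_apply, map_add, total_lof, ih,
      coe_remainder, add_sub_cancel]

theorem mem_range_total_iff {x : M} : x ∈ LinearMap.range s.total ↔ ∃ n, x ∈ D n := by
  classical
  constructor
  · rintro ⟨σ, rfl⟩
    refine ⟨(DFinsupp.support σ).sup id, ?_⟩
    rw [s.total_eq_sum]
    exact sum_mem fun i hi =>
      IsFiltration.mono (F := D) (Finset.le_sup (f := id) hi) (s.quant i (σ i)).2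
  · rintro ⟨N, hx⟩
    exact ⟨s.deform 1 N ⟨x, hx⟩, s.total_deform_one N ⟨x, hx⟩⟩

end NatIndexed

section Products

variable {k B : Type*} [CommRing k] [Ring B] [Algebra k B]

theorem symb_mul_congr {ι : Type*} [AddMonoid ι] [PartialOrder ι]
    [AddLeftStrictMono ι] [AddRightStrictMono ι] {D DLT : ι → Submodule k B}
    [IsRingFiltration D DLT] {S : ι → Type*} [∀ i, AddCommGroup (S i)] [∀ i, Module k (S i)]
    (s : SplitFiltration D DLT S) {i j : ι} {x x' : D i} {y y' : D j}
    (hx : s.symb i x = s.symb i x') (hy : s.symb j y = s.symb j y') :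
    s.symb (i + j) ⟨x * y, SetLike.mul_mem_graded x.2 y.2⟩ =
      s.symb (i + j) ⟨x' * y', SetLike.mul_mem_graded x'.2 y'.2⟩ := by
  rw [symb_eq_symb_iff] at hx hy ⊢
  have h : (x * y - x' * y' : B) = (x - x') * y + x' * (y - y') := by noncomm_ring
  rw [h]
  exact add_mem (filtrationLT_mul_mem hx y.2) (mul_filtrationLT_mem x'.2 hy)

variable {D DLT : ℕ → Submodule k B} [IsRingFiltration D DLT]
  {S : ℕ → Type*} [∀ n, AddCommGroup (S n)] [∀ n, Module k (S n)]
  (s : SplitFiltration D DLT S)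

/-- A bilinear operation on symbols is the star product `⋆_ħ` if it sends homogeneous `a`, `b` of
degrees `n`, `m` to `∑ᵢ ħⁱ [q(a) q(b)]^{n+m-i}`. -/
def IsStarProduct (ħ : k) (star : (⨁ n, S n) →ₗ[k] (⨁ n, S n) →ₗ[k] ⨁ n, S n) : Prop :=
  ∀ n m (a : S n) (b : S m), star (DirectSum.lof k ℕ S n a) (DirectSum.lof k ℕ S m b) =
    s.deform ħ (n + m) ⟨s.quant n a * s.quant m b,
      SetLike.mul_mem_graded (s.quant n a).2 (s.quant m b).2⟩

variable {s} {star : (⨁ n, S n) →ₗ[k] (⨁ n, S n) →ₗ[k] ⨁ n, S n}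

theorem IsStarProduct.apply_symb (h : s.IsStarProduct 0 star) (n m : ℕ) (x : D n) (y : D m) :
    star (DirectSum.lof k ℕ S n (s.symb n x)) (DirectSum.lof k ℕ S m (s.symb m y)) =
      DirectSum.lof k ℕ S (n + m) (s.symb (n + m) ⟨x * y, SetLike.mul_mem_graded x.2 y.2⟩) := by
  rw [h, deform_zero_left, LinearMap.comp_apply,
    s.symb_mul_congr (s.symb_quant n _) (s.symb_quant m _)]

theorem IsStarProduct.total_apply (h : s.IsStarProduct 1 star) (a b : ⨁ n, S n) :
    s.total (star a b) = s.total a * s.total b := by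
  suffices star.compr₂ s.total = (LinearMap.mul k B).compl₁₂ s.total s.total from
    LinearMap.congr_fun₂ this a b
  ext n a m b
  simp only [LinearMap.comp_apply, LinearMap.compr₂_apply, LinearMap.compl₁₂_apply,
    LinearMap.mul_apply', total_lof]
  rw [h, total_deform_one]

/-- The full quantization, onto the subalgebra of the elements of finite order. -/
def totalEquiv (s : SplitFiltration D DLT S) (U : Subalgebra k B)
    (hU : ∀ x, x ∈ U ↔ ∃ n, x ∈ D n) : (⨁ n, S n) ≃ₗ[k] U :=
  LinearEquiv.ofInjective s.total s.total_injective ≪≫ₗ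
    LinearEquiv.ofEq _ (Subalgebra.toSubmodule U)
      (Submodule.ext fun x => s.mem_range_total_iff.trans (hU x).symm)

theorem coe_totalEquiv (U : Subalgebra k B) (hU : ∀ x, x ∈ U ↔ ∃ n, x ∈ D n) (σ : ⨁ n, S n) :
    (s.totalEquiv U hU σ : B) = s.total σ :=
  rfl

end Products

end SplitFiltration

end NCDiff

open NCDiff in
theorem proposition5p41_general {k B : Type*} [CommRing k] [Ring B] [Algebra k B]
    {D DLT : ℕ → Submodule k B} [IsRingFiltration D DLT]
    {S : ℕ → Type*} [∀ n, AddCommGroup (S n)] [∀ n, Module k (S n)] (s : SplitFiltration D DLT S)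
    (U : Subalgebra k B) (hU : ∀ x, x ∈ U ↔ ∃ n, x ∈ D n)
    (star : k → (⨁ n, S n) →ₗ[k] (⨁ n, S n) →ₗ[k] ⨁ n, S n)
    (hstar : ∀ ħ, s.IsStarProduct ħ (star ħ)) :
    (∀ n m (x : D n) (y : D m),
      star 0 (DirectSum.lof k ℕ S n (s.symb n x)) (DirectSum.lof k ℕ S m (s.symb m y)) =
        DirectSum.lof k ℕ S (n + m) (s.symb (n + m) ⟨x * y, SetLike.mul_mem_graded x.2 y.2⟩)) ∧
    ∃ Φ : (⨁ n, S n) ≃ₗ[k] U,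
      (∀ σ, (Φ σ : B) = s.total σ) ∧
      Φ (DirectSum.lof k ℕ S 0 (s.symb 0 ⟨1, SetLike.one_mem_graded D⟩)) = 1 ∧
      ∀ a b, Φ (star 1 a b) = Φ a * Φ b := by
  refine ⟨(hstar 0).apply_symb, s.totalEquiv U hU, s.coe_totalEquiv U hU, ?_, fun a b => ?_⟩
  · refine Subtype.ext ?_
    rw [s.coe_totalEquiv, s.total_lof, s.quant_zero_symb]
    rfl
  · exact Subtype.ext ((hstar 1).total_apply a b)

namespace NCDiff.ExtAlg

variable {k : Type w} {A : Type u} {Ω : Type v} [CommRing k] [Ring A] [Algebra k A]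
  [Ring Ω] [Algebra k Ω] {Γ : ExtAlg k A Ω}
  {E : Type u} [AddCommGroup E] [Module k E] [Module A E] [IsScalarTower k A E]
  {F : Type u} [AddCommGroup F] [Module k F] [Module A F] [IsScalarTower k A F]

instance : IsFiltration (Γ.Diff E F) (Γ.DiffLT E F) where
  mono _ _ := Γ.Diff_mono E F
  is_le {i j} h := by
    cases j with
    | zero => exact absurd h i.not_lt_zero
    | succ j => exact Γ.Diff_mono E F (Nat.lt_succ_iff.1 h)
  is_sup P j h := by
    cases j with
    | zero => exact bot_le
    | succ j => exact h j j.lt_succ_self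

instance : IsRingFiltration (Γ.Diff E E) (Γ.DiffLT E E) where
  one_mem := Γ.linear_mem_Diff LinearMap.id fun _ => rfl
  mul_mem _ _ _ _ := Γ.comp_mem_Diff

theorem eq_symbMul {f : Γ.SymbAll E E →ₗ[k] Γ.SymbAll E E →ₗ[k] Γ.SymbAll E E}
    (h : ∀ n m (Δ₁ : Γ.Diff E E n) (Δ₂ : Γ.Diff E E m),
      f (DirectSum.lof k ℕ (Γ.Symb E E) n (Γ.symb E E n Δ₁))
          (DirectSum.lof k ℕ (Γ.Symb E E) m (Γ.symb E E m Δ₂)) =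
        DirectSum.lof k ℕ (Γ.Symb E E) (n + m) (Γ.symb E E (n + m) (Γ.compDiff E n m Δ₁ Δ₂))) :
    f = Γ.symbMul E := by
  ext n a m b : 4
  obtain ⟨Δ₁, rfl⟩ := Γ.symb_surjective E E n a
  obtain ⟨Δ₂, rfl⟩ := Γ.symb_surjective E E m b
  refine (h n m Δ₁ Δ₂).trans ?_
  rw [LinearMap.comp_apply, LinearMap.comp_apply, symbMul, gradedBilin_lof, LinearMap.compr₂_apply,
    symbMulHom_symb]

namespace Quantization

variable (q : Γ.Quantization E F) (p : Γ.Quantization E E)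

theorem trunc_self (n : ℕ) : q.trunc n n = LinearMap.id := by
  rw [trunc, dif_pos le_rfl]
  rfl

theorem trunc_of_lt {n i : ℕ} (h : i < n) : q.trunc n i = q.step i ∘ₗ q.trunc n (i + 1) := by
  rw [trunc, dif_neg h.not_ge]

theorem trunc_succ {N i : ℕ} (h : i ≤ N) : q.trunc (N + 1) i = q.trunc N i ∘ₗ q.step N := by
  induction h using Nat.decreasingInduction with
  | self => rw [trunc_of_lt q N.lt_succ_self, trunc_self, trunc_self, LinearMap.comp_id,
      LinearMap.id_comp]
  | of_succ i h ih => rw [trunc_of_lt q (Nat.lt_succ_of_lt h), ih, trunc_of_lt q h,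
      LinearMap.comp_assoc]

theorem part_self (n : ℕ) : q.part n n = Γ.symb E F n := by
  rw [part, trunc_self, LinearMap.comp_id]

theorem part_succ {N i : ℕ} (h : i ≤ N) : q.part (N + 1) i = q.part N i ∘ₗ q.step N := by
  rw [part, part, trunc_succ q h, LinearMap.comp_assoc]

theorem deform_zero (ħ : k) :
    p.deform ħ 0 = DirectSum.lof k ℕ (Γ.Symb E E) 0 ∘ₗ Γ.symb E E 0 := by
  rw [deform, Finset.sum_range_one, pow_zero, one_smul, Nat.sub_zero, part_self]

theorem deform_succ (ħ : k) (N : ℕ) :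
    p.deform ħ (N + 1) = DirectSum.lof k ℕ (Γ.Symb E E) (N + 1) ∘ₗ Γ.symb E E (N + 1)
      + ħ • p.deform ħ N ∘ₗ p.step N := by
  rw [deform, Finset.sum_range_succ', pow_zero, one_smul, Nat.sub_zero, part_self,
    add_comm (Finset.sum _ _), deform]
  refine congrArg _ (LinearMap.ext fun x => ?_)
  simp only [LinearMap.smul_apply, LinearMap.comp_apply, LinearMap.sum_apply, Finset.smul_sum]
  refine Finset.sum_congr rfl fun i _ => ?_
  rw [Nat.add_sub_add_right, part_succ p (Nat.sub_le N i), pow_succ', mul_smul,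
    LinearMap.comp_apply]

/-- The quantization as a splitting of the filtration by order. -/
def toSplitFiltration : SplitFiltration (Γ.Diff E F) (Γ.DiffLT E F) (Γ.Symb E F) where
  symb := Γ.symb E F
  symb_eq_zero_iff := Γ.symb_eq_zero_iff E F
  quant := q.q
  symb_quant := q.symb_q

theorem toSplitFiltration_deform (ħ : k) (N : ℕ) :
    p.toSplitFiltration.deform ħ N = p.deform ħ N := by
  induction N with
  | zero => exact (p.deform_zero ħ).symm
  | succ N ih =>
    rw [SplitFiltration.deform, ih, deform_succ]
    rfl

theorem isStarProduct_star (ħ : k) : p.toSplitFiltration.IsStarProduct ħ (p.star ħ) := by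
  intro n m a b
  rw [toSplitFiltration_deform, star, gradedBilin_lof]
  rfl

theorem coe_full (σ : Γ.SymbAll E E) :
    (p.full σ : Module.End k E) = p.toSplitFiltration.total σ := by
  suffices (Γ.DiffAlg E).val.toLinearMap ∘ₗ p.full = p.toSplitFiltration.total from
    LinearMap.congr_fun this σ
  ext n a : 2
  simp only [LinearMap.comp_apply, full, DirectSum.toModule_lof, SplitFiltration.total_lof]
  rfl

end Quantization

end NCDiff.ExtAlg

end

theorem proposition5p41 {k : Type w} {A : Type u} {Ω : Type v} [CommRing k] [Ring A] [Algebra k A]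
    [Ring Ω] [Algebra k Ω] (Γ : NCDiff.ExtAlg k A Ω)
    (E : Type u) [AddCommGroup E] [Module k E] [Module A E] [IsScalarTower k A E]
    (q : Γ.Quantization E E) :
    q.star 0 = Γ.symbMul E ∧
    ∃ Φ : Γ.SymbAll E E ≃ₗ[k] ↥(Γ.DiffAlg E),
      (∀ σ, Φ σ = q.full σ) ∧ Φ (Γ.symbOne E) = 1 ∧ ∀ a b, Φ (q.star 1 a b) = Φ a * Φ b := by
  obtain ⟨symb_mul, Φ, coe_Φ, Φ_one, Φ_mul⟩ := proposition5p41_general q.toSplitFiltration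
    (Γ.DiffAlg E) (fun _ => Iff.rfl) q.star q.isStarProduct_star
  exact ⟨NCDiff.ExtAlg.eq_symbMul symb_mul, Φ,
    fun σ => Subtype.ext ((coe_Φ σ).trans (q.coe_full σ).symm), Φ_one, Φ_mul⟩
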